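/- Let $G$ be a compact Lie group with simple Lie algebra $\mathfrak g$, let $Q$ be the negative of the Killing form of $\mathfrak g$, and let $K\subset G$ be a closed subgroup with Lie algebra $\mathfrak k$. Let $\mathfrak a$ be the $Q$-orthogonal complement of $\mathfrak k$ in $\mathfrak g$, let $\mathfrak z(\mathfrak k)$ be the centre of $\mathfrak k$, and let $\mathfrak k_1,\dots,\mathfrak k_r$ be the simple ideals of $\mathfrak k$, so that $$\mathfrak g=\mathfrak a\oplus\mathfrak z(\mathfrak k)\oplus\mathfrak k_1\oplus\cdots\oplus\mathfrak k_r .$$ Put $n=\dim\mathfrak a$, $s=\dim\mathfrak z(\mathfrak k)$, $d_i=\dim\mathfrak k_i$, and let $\kappa_i$ be the constant such that the Killing form of $\mathfrak k_i$ equals $-\kappa_i\,Q|_{\mathfrak k_i}$. Let $\mathcal M_K$ be the set of left-invariant Riemannian metrics on $G$ which, as inner products on $\mathfrak g$, have the form $$g=\alpha\,Q|_{\mathfrak a}+h+\alpha_1\,Q|_{\mathfrak k_1}+\cdots+\alpha_r\,Q|_{\mathfrak k_r}$$ for some inner product $h$ on $\mathfrak z(\mathfrak k)$ and some positive constants $\alpha,\alpha_1,\dots,\alpha_r$.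 Theorem. Assume that $\mathrm{Ad}(K)$ acts irreducibly on $\mathfrak a$ (in particular $\mathfrak a\neq 0$). Let $T\in\mathcal M_K$, written as $$T=T_{\mathfrak a}\,Q|_{\mathfrak a}+w+T_1\,Q|_{\mathfrak k_1}+\cdots+T_r\,Q|_{\mathfrak k_r}$$ with an inner product $w$ on $\mathfrak z(\mathfrak k)$ and positive constants $T_{\mathfrak a},T_1,\dots,T_r$. If there exist $g\in\mathcal M_K$ and $c>0$ such that $\mathrm{Ric}_g=cT$, then $$n\,T_{\mathfrak a}\,\max_{i=1,\dots,r}\frac{\kappa_i}{T_i}\;<\;2\sum_{j=1}^{r}d_j(1-\kappa_j)+2s+n ,$$ where the maximum is read as $0$ if $r=0$. -/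

import Mathlib

open scoped Manifold ContDiff

noncomputable section

namespace PrescribedRicci

universe u v w

variable {E : Type u} [NormedAddCommGroup E] [NormedSpace ℝ E]
  {H : Type v} [TopologicalSpace H] (I : ModelWithCorners ℝ E H)

section Riemannian

variable {M : Type w} [TopologicalSpace M] [ChartedSpace H M]

/-- A field of bilinear forms, i.e. a (0,2)-tensor field, on the manifold `M`. -/
abbrev TensorField (M : Type w) [TopologicalSpace M] [ChartedSpace H M] : Type (max u w) :=
  ∀ x : M, LinearMap.BilinForm ℝ (TangentSpace I x)

/-- `X` is a `C^∞` vector field on `M`. -/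
def IsSmoothField [IsManifold I ∞ M] (X : ∀ x : M, TangentSpace I x) : Prop :=
  ContMDiff I I.tangent ∞ (fun x ↦ (⟨x, X x⟩ : TangentBundle I M))

variable {I} in
/-- `∇_X Y`. (In Mathlib `(∇_X Y)(x)` is written `cov Y x (X x)`.) -/
def covDeriv [IsManifold I ∞ M] (cov : CovariantDerivative I E (TangentSpace I : M → Type u))
    (X Y : ∀ x : M, TangentSpace I x) : ∀ x : M, TangentSpace I x :=
  fun x ↦ cov Y x (X x)

/-- `cov` is the Levi-Civita connection of the Riemannian metric `g`:
`X(g(Y,Z)) = g(∇_X Y, Z) + g(Y, ∇_X Z)` and `∇_X Y - ∇_Y X = [X,Y]` for all smooth vector fields. -/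
structure IsLeviCivita [IsManifold I ∞ M] (g : TensorField I M)
    (cov : CovariantDerivative I E (TangentSpace I : M → Type u)) : Prop where
  metric : ∀ X Y Z : (∀ x : M, TangentSpace I x),
    IsSmoothField I X → IsSmoothField I Y → IsSmoothField I Z → ∀ x : M,
      mvfderiv I (fun y ↦ g y (Y y) (Z y)) x (X x) =
        g x (covDeriv cov X Y x) (Z x) + g x (Y x) (covDeriv cov X Z x)
  torsion_free : ∀ X Y : (∀ x : M, TangentSpace I x),
    IsSmoothField I X → IsSmoothField I Y → ∀ x : M,
      covDeriv cov X Y x - covDeriv cov Y X x = VectorField.mlieBracket I X Y x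

/-- `R` is the curvature tensor of `cov`:
`R(X,Y)Z = ∇_X ∇_Y Z - ∇_Y ∇_X Z - ∇_{[X,Y]} Z` for all smooth vector fields. -/
def IsCurvatureTensor [IsManifold I ∞ M]
    (cov : CovariantDerivative I E (TangentSpace I : M → Type u))
    (R : ∀ x : M, TangentSpace I x →ₗ[ℝ] TangentSpace I x →ₗ[ℝ]
      TangentSpace I x →ₗ[ℝ] TangentSpace I x) : Prop :=
  ∀ X Y Z : (∀ x : M, TangentSpace I x),
    IsSmoothField I X → IsSmoothField I Y → IsSmoothField I Z → ∀ x : M,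
      R x (X x) (Y x) (Z x) =
        covDeriv cov X (covDeriv cov Y Z) x - covDeriv cov Y (covDeriv cov X Z) x
          - covDeriv cov (VectorField.mlieBracket I X Y) Z x

/-- `Ric_g = S`: the (0,2)-tensor field `S` is the Ricci curvature of the Riemannian metric `g`,
that is `S(u,v) = tr (w ↦ R(w,u)v)` for the curvature tensor `R` of the Levi-Civita connection
of `g`. -/
def HasRicci [IsManifold I ∞ M] (g S : TensorField I M) : Prop :=
  ∃ (cov : CovariantDerivative I E (TangentSpace I : M → Type u))
    (R : ∀ x : M, TangentSpace I x →ₗ[ℝ] TangentSpace I x →ₗ[ℝ]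
      TangentSpace I x →ₗ[ℝ] TangentSpace I x),
    IsLeviCivita I g cov ∧ IsCurvatureTensor I cov R ∧
    ∀ (x : M) (u v : TangentSpace I x),
      S x u v = LinearMap.trace ℝ (TangentSpace I x)
        ((LinearMap.applyₗ v) ∘ₗ ((R x).flip u))

end Riemannian

/-- A symmetric positive definite bilinear form on a real vector space. -/
structure IsInnerProduct {V : Type*} [AddCommGroup V] [Module ℝ V]
    (B : LinearMap.BilinForm ℝ V) : Prop where
  symm : ∀ x y, B x y = B y x
  pos : ∀ x, x ≠ 0 → 0 < B x x

section LieGroup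

variable (G : Type w) [TopologicalSpace G] [ChartedSpace H G] [Group G]

variable {G} in
/-- The left-invariant (0,2)-tensor field on `G` which is `B` at the identity: at `x` it is the
pull-back of `B` under the derivative of left translation by `x⁻¹`. -/
def leftInvariant (B : LinearMap.BilinForm ℝ (GroupLieAlgebra I G)) : TensorField I G :=
  fun x ↦
    let dL : TangentSpace I x →ₗ[ℝ] GroupLieAlgebra I G :=
      (show E →L[ℝ] E from mfderiv I I (fun y : G ↦ x⁻¹ * y) x).toLinearMap
    B.compl₁₂ dL dL

variable {G} in
/-- The adjoint action `Ad(x)` on the Lie algebra: the derivative at `1` of `y ↦ x y x⁻¹`. -/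
def Ad (x : G) : GroupLieAlgebra I G →ₗ[ℝ] GroupLieAlgebra I G :=
  (show E →L[ℝ] E from mfderiv I I (fun y : G ↦ x * y * x⁻¹) 1).toLinearMap

variable [LieGroup I ∞ G]

instance instLieGroupMinSmoothness : LieGroup I (minSmoothness ℝ 3) G := by
  rw [minSmoothness_of_isRCLikeNormedField]; infer_instance

instance instIsManifoldInfty : IsManifold I ∞ G := ContMDiffMul.toIsManifold

variable [CompleteSpace E]

/-- `Q`, the negative of the Killing form of the Lie algebra of `G`. -/
def Q : LinearMap.BilinForm ℝ (GroupLieAlgebra I G) := -killingForm ℝ (GroupLieAlgebra I G)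

variable {G} (K : Subgroup G)

/-- The Lie algebra `𝔨` of a closed subgroup `K` of `G`: the set of all `X` with `exp (tX) ∈ K` for
all real `t`, where `t ↦ exp (tX)` is the integral curve through `1` of the left-invariant vector
field of `X`. For closed `K` this set is a Lie subalgebra (Cartan), so that taking the Lie
subalgebra that it generates adds nothing. -/
def lieAlgebraOf : LieSubalgebra ℝ (GroupLieAlgebra I G) :=
  LieSubalgebra.lieSpan ℝ (GroupLieAlgebra I G)
    {X | ∃ γ : ℝ → G, γ 0 = 1 ∧ IsMIntegralCurve (I := I) γ (mulInvariantVectorField X) ∧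
      ∀ t, γ t ∈ K}

/-- `𝔞`, the `Q`-orthogonal complement of `𝔨` in the Lie algebra of `G`. -/
def compl : Submodule ℝ (GroupLieAlgebra I G) :=
  (Q I G).orthogonal (lieAlgebraOf I K).toSubmodule

/-- `Ad(K)` acts irreducibly on `𝔞`. -/
def AdIrreducible : Prop :=
  compl I K ≠ ⊥ ∧
    ∀ W : Submodule ℝ (GroupLieAlgebra I G), W ≤ compl I K →
      (∀ x ∈ K, ∀ X ∈ W, Ad I x X ∈ W) → W = ⊥ ∨ W = compl I K

/-- The simple ideals of `𝔨`. -/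
abbrev SimpleIdeal : Type u :=
  {J : LieIdeal ℝ (lieAlgebraOf I K) // LieAlgebra.IsSimple ℝ J}

variable {I K}

/-- The constant `κ` of a simple ideal `J` of `𝔨`: the number with `B_J = -κ Q|_J`, where `B_J` is
the Killing form of `J`. -/
def kappa (J : SimpleIdeal I K) : ℝ :=
  Classical.epsilon fun κ : ℝ ↦ ∀ x y : J.1,
    killingForm ℝ J.1 x y = -κ * Q I G ((x : lieAlgebraOf I K) : GroupLieAlgebra I G)
      ((y : lieAlgebraOf I K) : GroupLieAlgebra I G)

/-- The inner product `g` on the Lie algebra of `G` defines a metric in `𝓜_K`, with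
`g = α Q|_𝔞 + h + α₁ Q|_{𝔨₁} + ⋯ + α_r Q|_{𝔨_r}` in terms of the splitting
`𝔤 = 𝔞 ⊕ 𝔷(𝔨) ⊕ 𝔨₁ ⊕ ⋯ ⊕ 𝔨_r`. Here `𝔨₁, …, 𝔨_r` are the simple ideals of `𝔨`, the numbers
`α, α₁, …, α_r` are positive and `h` is an inner product on the centre `𝔷(𝔨)` of `𝔨`. -/
structure IsMetricOfForm {r : ℕ} (k : Fin r ≃ SimpleIdeal I K)
    (g : LinearMap.BilinForm ℝ (GroupLieAlgebra I G)) (α : ℝ)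
    (h : LinearMap.BilinForm ℝ (LieAlgebra.center ℝ (lieAlgebraOf I K)))
    (αs : Fin r → ℝ) : Prop where
  isInnerProduct : IsInnerProduct g
  pos : 0 < α
  isInnerProduct_center : IsInnerProduct h
  pos_ideal : ∀ i, 0 < αs i
  form : ∀ (a a' : compl I K) (z z' : LieAlgebra.center ℝ (lieAlgebraOf I K))
    (x x' : ∀ i, (k i).1),
    g ((a : GroupLieAlgebra I G) + ((z : lieAlgebraOf I K) : GroupLieAlgebra I G)
          + ∑ i, ((x i : lieAlgebraOf I K) : GroupLieAlgebra I G))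
        ((a' : GroupLieAlgebra I G) + ((z' : lieAlgebraOf I K) : GroupLieAlgebra I G)
          + ∑ i, ((x' i : lieAlgebraOf I K) : GroupLieAlgebra I G))
      = α * Q I G (a : GroupLieAlgebra I G) (a' : GroupLieAlgebra I G) + h z z'
        + ∑ i, αs i * Q I G ((x i : lieAlgebraOf I K) : GroupLieAlgebra I G)
            ((x' i : lieAlgebraOf I K) : GroupLieAlgebra I G)

end LieGroup

end PrescribedRicci

end

noncomputable section

namespace PrescribedRicci

universe u v w

/-! ### Left-invariant vector fields and tensors. -/

section Geometry

open Bundle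

variable {E : Type u} [NormedAddCommGroup E] [NormedSpace ℝ E]
  {H : Type v} [TopologicalSpace H] {I : ModelWithCorners ℝ E H}
  {G : Type w} [TopologicalSpace G] [ChartedSpace H G] [Group G]

/-! The argument compares two traces of the equation `Ric_g = c T`. Averaging over the compact group
gives an `ad`-invariant inner product; since the centre of the simple Lie algebra vanishes, `Q` is
positive definite. Take a `Q`-orthonormal basis adapted to the splitting and diagonalizing `g`, with
weights `p`. With `c_{vij} = Q([b_v, b_i], b_j)`, the Koszul formula gives `Ric(b_v, b_v) = ∑
c_{vij}² (p_v² - (p_i - p_j)²) / (4 p_i p_j)` (`trace_ricci_basis`). As `Q` is minus the Killing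
form, the numbers `c_{vij}²` sum to `1` over `i, j` for each `v`, and they are invariant under
permutations of the indices.

For `x` in `𝔨` let `N(x)` be the sum of `c_{xaa'}²` over `a, a'` in `𝔞`. It is `1` on the centre and
`1 - κ_j` on `𝔨_j`, so its total is `W = s + ∑ d_j (1 - κ_j)`. Summing Ricci over `𝔞`, each term
with one index in `𝔨` has coefficient at most `1/2`, and the terms within `𝔞` have coefficient
`1/4`; this yields `n c T_𝔞 ≤ (2W + n)/4` (`sum_ricci_normal_le`).

On `𝔨_i` the Ricci curvature is exactly `(κ_i + (1 - κ_i)(α_i/α)²)/4` (`ricci_isotropy_eq`). Here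
`κ_i < 1`: otherwise `𝔨_i` commutes with `𝔞` and is an ideal of `𝔤`, which simplicity and `𝔞 ≠ 0`
exclude (`orthogonal_eq_bot_of_lie_eq_zero`). Hence `κ_i / T_i < 4c`, and eliminating `c` gives the
strict inequality. -/

lemma mulInvariantVectorField_one (X : GroupLieAlgebra I G) :
    mulInvariantVectorField X (1 : G) = X := by
  have h : mfderiv I I (fun y : G ↦ 1 * y) (1 : G) = ContinuousLinearMap.id ℝ E := by
    have e : (fun y : G ↦ 1 * y) = id := by ext; simp
    rw [e]; exact mfderiv_id
  exact congrArg (fun f : E →L[ℝ] E ↦ f X) h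

variable [LieGroup I ∞ G]

lemma mdifferentiableAt_mul_left (x y : G) : MDifferentiableAt I I (fun z : G ↦ x * z) y :=
  (contMDiff_mul_left (I := I) (n := ∞) (a := x)).contMDiffAt.mdifferentiableAt (by simp)

lemma mdifferentiableAt_conj (x y : G) : MDifferentiableAt I I (fun z : G ↦ x * z * x⁻¹) y :=
  ((contMDiff_mul_right (I := I) (n := ∞) (a := x⁻¹)).comp
    (contMDiff_mul_left (I := I) (n := ∞) (a := x))).contMDiffAt.mdifferentiableAt (by simp)

lemma isSmoothField_mulInvariantVectorField (X : GroupLieAlgebra I G) :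
    IsSmoothField I (mulInvariantVectorField X : ∀ x : G, TangentSpace I x) := by
  -- The field is the tangent map of the multiplication `G × G → G` applied to the smooth section `g
  -- ↦ (0_g, X)`.
  have S₁ : ContMDiff I (I.tangent.prod I.tangent) ∞ (fun g : G ↦
      ((TotalSpace.mk' E g 0 : TangentBundle I G), (TotalSpace.mk' E 1 X : TangentBundle I G))) :=
    (contMDiff_zeroSection _ _).prodMk contMDiff_const
  have S₂ : ContMDiff (I.tangent.prod I.tangent) (I.prod I).tangent ∞
      (equivTangentBundleProd I G I G).symm := contMDiff_equivTangentBundleProd_symm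
  have S₃ : ContMDiff (I.prod I).tangent I.tangent ∞
      (tangentMap (I.prod I) I (fun p : G × G ↦ p.1 * p.2)) :=
    ContMDiff.contMDiff_tangentMap (contMDiff_mul I ∞) (by norm_num)
  have S := (S₃.comp S₂).comp S₁
  unfold IsSmoothField
  convert! S with g
  · simp
  · simp only [Function.comp_apply, tangentMap]
    rw [mfderiv_prod_eq_add_apply ((contMDiff_mul I ∞).mdifferentiableAt (by simp))]
    change (show E →L[ℝ] E from mfderiv I I (fun x : G ↦ g * x) 1) X =
      (show E →L[ℝ] E from mfderiv I I (fun z : G ↦ z * 1) g) 0 +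
        (show E →L[ℝ] E from mfderiv I I (fun x : G ↦ g * x) 1) X
    rw [map_zero, zero_add]

lemma mfderiv_mul_left_inv_apply (x : G) (X : GroupLieAlgebra I G) :
    (show E →L[ℝ] E from mfderiv I I (fun y : G ↦ x⁻¹ * y) x)
      (mulInvariantVectorField X x) = X := by
  have h : mfderiv I I ((fun y : G ↦ x⁻¹ * y) ∘ (fun y : G ↦ x * y)) 1 =
      ContinuousLinearMap.id ℝ E := by
    have : (fun y : G ↦ x⁻¹ * y) ∘ (fun y : G ↦ x * y) = id := by ext; simp
    rw [this]; exact mfderiv_id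
  rw [mfderiv_comp (I' := I) _ (mdifferentiableAt_mul_left _ _)
    (mdifferentiableAt_mul_left _ _)] at h
  have h' := congrArg (fun f : E →L[ℝ] E ↦ f X) h
  have e : x * 1 = x := mul_one x
  simp only [mulInvariantVectorField]
  rw [e] at h'
  exact h'

lemma mulInvariantVectorField_mfderiv_inv (x : G) (v : TangentSpace I x) :
    mulInvariantVectorField (I := I) ((show E →L[ℝ] E from mfderiv I I (fun y : G ↦ x⁻¹ * y) x) v :
      GroupLieAlgebra I G) x = v := by
  have h : mfderiv I I ((fun y : G ↦ x * y) ∘ (fun y : G ↦ x⁻¹ * y)) x =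
      ContinuousLinearMap.id ℝ E := by
    have : (fun y : G ↦ x * y) ∘ (fun y : G ↦ x⁻¹ * y) = id := by ext; simp
    rw [this]; exact mfderiv_id
  rw [mfderiv_comp (I' := I) _ (mdifferentiableAt_mul_left _ _)
    (mdifferentiableAt_mul_left _ _)] at h
  have h' := congrArg (fun f : E →L[ℝ] E ↦ f v) h
  have e : x⁻¹ * x = 1 := inv_mul_cancel x
  simp only [mulInvariantVectorField]
  rw [e] at h'
  exact h'

lemma leftInvariant_apply (B : LinearMap.BilinForm ℝ (GroupLieAlgebra I G)) (x : G)
    (X Y : GroupLieAlgebra I G) :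
    leftInvariant I B x (mulInvariantVectorField X x) (mulInvariantVectorField Y x) = B X Y := by
  have h1 := mfderiv_mul_left_inv_apply (I := I) x X
  have h2 := mfderiv_mul_left_inv_apply (I := I) x Y
  unfold leftInvariant
  exact congrArg₂ (fun a b ↦ B a b) h1 h2

lemma leftInvariant_one (B : LinearMap.BilinForm ℝ (GroupLieAlgebra I G))
    (X Y : GroupLieAlgebra I G) : leftInvariant I B (1 : G) X Y = B X Y := by
  have := leftInvariant_apply B (1 : G) X Y
  rwa [mulInvariantVectorField_one, mulInvariantVectorField_one] at this

/-- A product on `V` that is `B`-skew and whose commutator is the bracket is unique. -/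
lemma eq_of_skew_of_torsionFree {V : Type*} [AddCommGroup V] [Module ℝ V]
    {B : LinearMap.BilinForm ℝ V} (hB : IsInnerProduct B) {br Γ Γ' : V → V → V}
    (hs : ∀ X Y Z, B (Γ X Y) Z + B Y (Γ X Z) = 0) (hs' : ∀ X Y Z, B (Γ' X Y) Z + B Y (Γ' X Z) = 0)
    (ht : ∀ X Y, Γ X Y - Γ Y X = br X Y) (ht' : ∀ X Y, Γ' X Y - Γ' Y X = br X Y) :
    Γ = Γ' := by
  have sym : ∀ X Y, Γ X Y - Γ' X Y = Γ Y X - Γ' Y X := fun X Y ↦ by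
    have := (ht X Y).trans (ht' X Y).symm
    rw [sub_eq_sub_iff_add_eq_add] at this ⊢
    rw [this]; abel
  have skew : ∀ X Y Z, B (Γ X Y - Γ' X Y) Z = - B (Γ X Z - Γ' X Z) Y := fun X Y Z ↦ by
    rw [hB.symm _ Y]
    simp only [map_sub, LinearMap.sub_apply]
    linarith [hs X Y Z, hs' X Y Z]
  have key : ∀ X Y Z, B (Γ X Y - Γ' X Y) Z = 0 := fun X Y Z ↦ by
    have h1 : B (Γ X Y - Γ' X Y) Z = - B (Γ X Y - Γ' X Y) Z := by
      -- The difference of the products is symmetric in its arguments, and paired with `B` it is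
      -- skew in the last two. Three exchanges of each kind restore the arguments with sign `(-1)³`.
      conv_lhs => rw [skew, sym X Z, skew, sym Z Y, skew, sym Y X]
      simp
    linarith
  funext X Y
  by_contra h
  exact (hB.pos _ (sub_ne_zero.2 h)).ne' (key X Y _)

end Geometry

/-! ### The Levi-Civita connection and Ricci curvature of a left-invariant metric. -/

section LeviCivita

variable {E : Type u} [NormedAddCommGroup E] [NormedSpace ℝ E] [CompleteSpace E]
  {H : Type v} [TopologicalSpace H] {I : ModelWithCorners ℝ E H}
  {G : Type w} [TopologicalSpace G] [ChartedSpace H G] [Group G] [LieGroup I ∞ G]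

lemma mlieBracket_mulInvariantVectorField (X Y : GroupLieAlgebra I G) :
    VectorField.mlieBracket I (mulInvariantVectorField X : ∀ x : G, TangentSpace I x)
      (mulInvariantVectorField Y) = mulInvariantVectorField ⁅X, Y⁆ :=
  (mulInvariantVector_mlieBracket X Y).symm

/-- Left invariance of the connection follows from uniqueness: the components of `∇_X Y`, translated
back to `1` from any point, satisfy the same two algebraic conditions. -/
lemma IsLeviCivita.covDeriv_mulInvariantVectorField
    {B : LinearMap.BilinForm ℝ (GroupLieAlgebra I G)} (hB : IsInnerProduct B)
    {cov : CovariantDerivative I E (TangentSpace I : G → Type u)}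
    (h : IsLeviCivita I (leftInvariant I B) cov) :
    ∃ Γ : GroupLieAlgebra I G →ₗ[ℝ] GroupLieAlgebra I G →ₗ[ℝ] GroupLieAlgebra I G,
      (∀ X Y Z, B (Γ X Y) Z + B Y (Γ X Z) = 0) ∧ (∀ X Y, Γ X Y - Γ Y X = ⁅X, Y⁆) ∧
      ∀ X Y, covDeriv cov (mulInvariantVectorField X) (mulInvariantVectorField Y) =
        mulInvariantVectorField (Γ X Y) := by
  let D : G → GroupLieAlgebra I G → GroupLieAlgebra I G → GroupLieAlgebra I G := fun x X Y ↦
    (show E →L[ℝ] E from mfderiv I I (fun y : G ↦ x⁻¹ * y) x)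
      (covDeriv cov (mulInvariantVectorField X) (mulInvariantVectorField Y) x)
  have hD : ∀ x X Y, covDeriv cov (mulInvariantVectorField X) (mulInvariantVectorField Y) x =
      mulInvariantVectorField (D x X Y) x := fun x X Y ↦
    (mulInvariantVectorField_mfderiv_inv x _).symm
  have skew : ∀ x X Y Z, B (D x X Y) Z + B Y (D x X Z) = 0 := fun x X Y Z ↦ by
    have := h.metric _ _ _ (isSmoothField_mulInvariantVectorField X)
      (isSmoothField_mulInvariantVectorField Y) (isSmoothField_mulInvariantVectorField Z) x
    simp only [leftInvariant_apply, hD] at this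
    -- The function `g(Y, Z)` is constant for left-invariant `Y` and `Z`, so its derivative
    -- vanishes.
    rw [← this, mvfderiv_const]; rfl
  have tors : ∀ x X Y, D x X Y - D x Y X = ⁅X, Y⁆ := fun x X Y ↦ by
    have := h.torsion_free _ _ (isSmoothField_mulInvariantVectorField X)
      (isSmoothField_mulInvariantVectorField Y) x
    rw [mlieBracket_mulInvariantVectorField] at this
    have h2 := congrArg (show E →L[ℝ] E from mfderiv I I (fun y : G ↦ x⁻¹ * y) x) this
    erw [map_sub] at h2
    rw [← mfderiv_mul_left_inv_apply (I := I) x ⁅X, Y⁆]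
    exact h2
  have hDx : ∀ x, D x = D 1 := fun x ↦ eq_of_skew_of_torsionFree hB (skew x) (skew 1) (tors x)
    (tors 1)
  have hmd : ∀ (X : GroupLieAlgebra I G) (x : G), MDifferentiableAt I I.tangent
      (fun (g : G) ↦ (mulInvariantVectorField X g : TangentBundle I G)) x :=
    fun X x ↦ mdifferentiableAt_mulInvariantVectorField X
  have hD1 : ∀ X Y, D 1 X Y = cov (mulInvariantVectorField Y) 1 X := fun X Y ↦ by
    have := hD 1 X Y
    rw [mulInvariantVectorField_one] at this
    rw [← this]
    simp only [covDeriv]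
    rw [mulInvariantVectorField_one]
  refine ⟨LinearMap.mk₂ ℝ (D 1) ?_ ?_ ?_ ?_, skew 1, tors 1, fun X Y ↦ ?_⟩
  · intro X X' Y
    simp only [hD1]; exact map_add _ _ _
  · intro c X Y
    simp only [hD1]; exact map_smul _ _ _
  · intro X Y Y'
    simp only [hD1, mulInvariantVectorField_add]
    rw [cov.isCovariantDerivativeOnUniv.add (hmd _ _) (hmd _ _)]
    rfl
  · intro c X Y
    simp only [hD1, mulInvariantVectorField_smul]
    rw [cov.isCovariantDerivativeOnUniv.smul_const _ (hmd _ _)]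
    rfl
  · funext x
    rw [hD, hDx]; rfl

/-- Passage from geometry to algebra: evaluated at `1`, the Ricci equation becomes a trace identity
on the Lie algebra. -/
lemma HasRicci.exists_connection {B S : LinearMap.BilinForm ℝ (GroupLieAlgebra I G)}
    (hB : IsInnerProduct B) {c : ℝ}
    (h : HasRicci I (leftInvariant I B) (c • leftInvariant I S)) :
    ∃ Γ : GroupLieAlgebra I G →ₗ[ℝ] GroupLieAlgebra I G →ₗ[ℝ] GroupLieAlgebra I G,
      (∀ X Y Z, B (Γ X Y) Z + B Y (Γ X Z) = 0) ∧ (∀ X Y, Γ X Y - Γ Y X = ⁅X, Y⁆) ∧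
      ∀ v, ∃ Ric : GroupLieAlgebra I G →ₗ[ℝ] GroupLieAlgebra I G,
        (∀ w, Ric w = Γ w (Γ v v) - Γ v (Γ w v) - Γ ⁅w, v⁆ v) ∧
        c * S v v = LinearMap.trace ℝ _ Ric := by
  obtain ⟨cov, R, hLC, hR, hS⟩ := h
  obtain ⟨Γ, hs, ht, hΓ⟩ := hLC.covDeriv_mulInvariantVectorField hB
  refine ⟨Γ, hs, ht, fun v ↦ ⟨LinearMap.applyₗ v ∘ₗ (R 1).flip v, fun w ↦ ?_, ?_⟩⟩
  · have := hR _ _ _ (isSmoothField_mulInvariantVectorField w)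
      (isSmoothField_mulInvariantVectorField v) (isSmoothField_mulInvariantVectorField v) 1
    rw [mlieBracket_mulInvariantVectorField] at this
    simp only [hΓ, mulInvariantVectorField_one] at this
    exact this
  · rw [← hS 1 v v]
    change _ = c * leftInvariant I S (1 : G) v v
    rw [leftInvariant_one]

end LeviCivita

/-! ### Second derivatives of a local multiplication. -/

section Calculus

open Filter Topology

variable {E : Type*} [NormedAddCommGroup E] [NormedSpace ℝ E]

lemma fderiv_prodMk_right {m : E × E → E} {a b : E} (h : DifferentiableAt ℝ m (a, b)) :
    fderiv ℝ (fun y ↦ m (a, y)) b = (fderiv ℝ m (a, b)).comp (ContinuousLinearMap.inr ℝ E E) :=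
  (h.hasFDerivAt.comp b (hasFDerivAt_prodMk_right a b)).fderiv

lemma fderiv_prodMk_left {m : E × E → E} {a b : E} (h : DifferentiableAt ℝ m (a, b)) :
    fderiv ℝ (fun y ↦ m (y, b)) a = (fderiv ℝ m (a, b)).comp (ContinuousLinearMap.inl ℝ E E) :=
  (h.hasFDerivAt.comp a (hasFDerivAt_prodMk_left a b)).fderiv

lemma ContDiffAt.eventually_fderiv_prodMk_right {m : E × E → E} {e : E}
    (h : ContDiffAt ℝ 2 m (e, e)) :
    (fun a ↦ fderiv ℝ (fun y ↦ m (a, y)) e) =ᶠ[𝓝 e]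
      fun a ↦ (fderiv ℝ m (a, e)).comp (ContinuousLinearMap.inr ℝ E E) := by
  have h1 : ∀ᶠ p in 𝓝 (e, e), DifferentiableAt ℝ m p :=
    ((h.of_le (by norm_num : (1 : ℕ∞ω) ≤ 2)).eventually (by simp)).mono
      fun p hp ↦ hp.differentiableAt (by simp)
  have h2 : Tendsto (fun a : E ↦ (a, e)) (𝓝 e) (𝓝 (e, e)) :=
    (continuous_id.prodMk continuous_const).continuousAt
  filter_upwards [h2.eventually h1] with a ha using fderiv_prodMk_right ha

lemma ContDiffAt.hasFDerivAt_fderiv_prodMk_right {m : E × E → E} {e : E}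
    (h : ContDiffAt ℝ 2 m (e, e)) :
    DifferentiableAt ℝ (fun a ↦ fderiv ℝ (fun y ↦ m (a, y)) e) e ∧
      ∀ X Y, fderiv ℝ (fun a ↦ fderiv ℝ (fun y ↦ m (a, y)) e) e X Y =
        fderiv ℝ (fderiv ℝ m) (e, e) (X, 0) (0, Y) := by
  have hD : HasFDerivAt (fderiv ℝ m) (fderiv ℝ (fderiv ℝ m) (e, e)) (e, e) :=
    ((h.fderiv_right (m := 1) (by norm_num)).differentiableAt (by simp)).hasFDerivAt
  have h1 : HasFDerivAt (fun a ↦ fderiv ℝ m (a, e))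
      ((fderiv ℝ (fderiv ℝ m) (e, e)).comp (ContinuousLinearMap.inl ℝ E E)) e :=
    HasFDerivAt.comp (f := fun a ↦ (a, e)) e hD (hasFDerivAt_prodMk_left e e)
  have h2 := h1.clm_comp (hasFDerivAt_const (ContinuousLinearMap.inr ℝ E E) e)
  have h3 := h2.congr_of_eventuallyEq (ContDiffAt.eventually_fderiv_prodMk_right h)
  refine ⟨h3.differentiableAt, fun X Y ↦ ?_⟩
  rw [h3.fderiv]
  simp

/-- If `m` is a local multiplication with unit `e` and `C` the conjugation, then the derivative at
`e` of the differential of `C a` at `e` is the commutator of the second derivative of `m`. -/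
lemma fderiv_fderiv_conj {m C : E × E → E} {e : E} (hm : ContDiffAt ℝ 2 m (e, e))
    (hC : ContDiffAt ℝ 2 C (e, e)) (hCe : ∀ᶠ a in 𝓝 e, C (a, e) = e)
    (hmC : ∀ᶠ p in 𝓝 (e, e), m (C p, p.1) = m p)
    (hml : ∀ᶠ b in 𝓝 e, m (e, b) = b) (hmr : ∀ᶠ a in 𝓝 e, m (a, e) = a) :
    DifferentiableAt ℝ (fun a ↦ fderiv ℝ (fun b ↦ C (a, b)) e) e ∧
    fderiv ℝ (fun b ↦ C (e, b)) e = ContinuousLinearMap.id ℝ E ∧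
    fderiv ℝ (fun b ↦ m (e, b)) e = ContinuousLinearMap.id ℝ E ∧
    ∀ X Y, fderiv ℝ (fun a ↦ fderiv ℝ (fun b ↦ C (a, b)) e) e X Y =
      fderiv ℝ (fun a ↦ fderiv ℝ (fun b ↦ m (a, b)) e) e X Y -
      fderiv ℝ (fun a ↦ fderiv ℝ (fun b ↦ m (a, b)) e) e Y X := by
  obtain ⟨hLd, hL⟩ := ContDiffAt.hasFDerivAt_fderiv_prodMk_right hm
  obtain ⟨hAd, -⟩ := ContDiffAt.hasFDerivAt_fderiv_prodMk_right hC
  set A : E → E →L[ℝ] E := fun a ↦ fderiv ℝ (fun b ↦ C (a, b)) e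
  set L : E → E →L[ℝ] E := fun a ↦ fderiv ℝ (fun b ↦ m (a, b)) e
  let M : E → E →L[ℝ] E := fun a ↦ (fderiv ℝ m (e, a)).comp (ContinuousLinearMap.inl ℝ E E)
  have hD : HasFDerivAt (fderiv ℝ m) (fderiv ℝ (fderiv ℝ m) (e, e)) (e, e) :=
    ((hm.fderiv_right (m := 1) (by norm_num)).differentiableAt (by simp)).hasFDerivAt
  have hsymm : IsSymmSndFDerivAt ℝ m (e, e) := hm.isSymmSndFDerivAt (by simp)
  have hM : HasFDerivAt M _ e :=
    HasFDerivAt.clm_comp (hD.comp e (hasFDerivAt_prodMk_right e e))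
      (hasFDerivAt_const (ContinuousLinearMap.inl ℝ E E) e)
  have hmd : ∀ᶠ p in 𝓝 (e, e), DifferentiableAt ℝ m p :=
    ((hm.of_le (by norm_num : (1 : ℕ∞ω) ≤ 2)).eventually (by simp)).mono
      fun p hp ↦ hp.differentiableAt (by simp)
  have hCd : ∀ᶠ p in 𝓝 (e, e), DifferentiableAt ℝ C p :=
    ((hC.of_le (by norm_num : (1 : ℕ∞ω) ≤ 2)).eventually (by simp)).mono
      fun p hp ↦ hp.differentiableAt (by simp)
  have tl : Tendsto (fun a : E ↦ (a, e)) (𝓝 e) (𝓝 (e, e)) :=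
    (continuous_id.prodMk continuous_const).continuousAt
  have tr : Tendsto (fun a : E ↦ (e, a)) (𝓝 e) (𝓝 (e, e)) :=
    (continuous_const.prodMk continuous_id).continuousAt
  -- Differentiate `m (C (a, b), a) = m (a, b)` in `b` at `e`; `M a` and `L a` are the differentials
  -- at `e` of right and left multiplication by `a`.
  have hMA : (fun a ↦ (M a).comp (A a)) =ᶠ[𝓝 e] L := by
    filter_upwards [tl.eventually hCd, tr.eventually hmd, hCe,
      tl.eventually hmC.eventually_nhds] with a hCa hma hae hloc
    have h1 : HasFDerivAt (fun b ↦ C (a, b)) (A a) e :=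
      (hCa.comp e (hasFDerivAt_prodMk_right a e).differentiableAt).hasFDerivAt
    have h2 : HasFDerivAt (fun c ↦ m (c, a)) (M a) (C (a, e)) := by
      rw [hae]
      exact hma.hasFDerivAt.comp e (hasFDerivAt_prodMk_left e a)
    have h3 := (h2.comp e h1).fderiv
    have h4 : ∀ᶠ b in 𝓝 e, m (C (a, b), a) = m (a, b) :=
      (continuous_const.prodMk continuous_id).continuousAt.eventually hloc
    rw [← h3]
    exact Filter.EventuallyEq.fderiv_eq h4
  have hM1 : M e = ContinuousLinearMap.id ℝ E := by
    have h : fderiv ℝ (fun y ↦ m (y, e)) e = M e := fderiv_prodMk_left hmd.self_of_nhds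
    have h' : (fun y ↦ m (y, e)) =ᶠ[𝓝 e] id := hmr
    rw [← h, h'.fderiv_eq, fderiv_id]
  have hL1 : L e = ContinuousLinearMap.id ℝ E := by
    have h' : (fun y ↦ m (e, y)) =ᶠ[𝓝 e] id := hml
    change fderiv ℝ (fun y ↦ m (e, y)) e = _
    rw [h'.fderiv_eq, fderiv_id]
  have hA1 : A e = ContinuousLinearMap.id ℝ E := by
    have : (M e).comp (A e) = L e := hMA.self_of_nhds
    rwa [hM1, hL1, ContinuousLinearMap.id_comp] at this
  refine ⟨hAd, hA1, hL1, fun X Y ↦ ?_⟩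
  -- By the product rule the derivative of `A` is that of `L` minus that of `M`; symmetry of the
  -- second derivative of `m` turns the latter into that of `L` with `X` and `Y` exchanged.
  have h5 := hMA.fderiv_eq (𝕜 := ℝ)
  rw [(hM.clm_comp hAd.hasFDerivAt).fderiv] at h5
  have h6 := congrArg (fun f : E →L[ℝ] E →L[ℝ] E ↦ f X Y) h5
  simp only [hA1, hM1] at h6
  simp at h6
  rw [← h6, hL Y X, hsymm.eq]
  simp

end Calculus

/-! ### The bracket and the adjoint action in a chart at the identity. -/

section Chart

open Filter Topology Set VectorField

variable {E : Type u} [NormedAddCommGroup E] [NormedSpace ℝ E]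
  {H : Type v} [TopologicalSpace H] (I : ModelWithCorners ℝ E H)
  (G : Type w) [TopologicalSpace G] [ChartedSpace H G] [Group G]

/-- The multiplication of `G` in the preferred chart at `1`. -/
def chartMul (p : E × E) : E :=
  extChartAt I (1 : G) ((extChartAt I (1 : G)).symm p.1 * (extChartAt I (1 : G)).symm p.2)

/-- The conjugation `(a, b) ↦ a b a⁻¹` of `G` in the preferred chart at `1`. -/
def chartConj (p : E × E) : E :=
  extChartAt I (1 : G) ((extChartAt I (1 : G)).symm p.1 * (extChartAt I (1 : G)).symm p.2 *
    ((extChartAt I (1 : G)).symm p.1)⁻¹)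

lemma eventually_extChartAt_one {X : Type*} [TopologicalSpace X] {f : X → G} {x : X}
    (hf : ContinuousAt f x) (h : f x = 1) :
    ∀ᶠ y in 𝓝 x, f y ∈ (extChartAt I (1 : G)).source :=
  hf.eventually_mem (by rw [h]; exact extChartAt_source_mem_nhds 1)

lemma chartConj_one (a : E) : chartConj I G (a, extChartAt I (1 : G) 1) = extChartAt I (1 : G) 1 := by
  simp [chartConj]

lemma contDiffAt_chart {f : E × E → G} {p : E × E}
    (hf : ContMDiffAt 𝓘(ℝ, E × E) I ∞ f p) (h : f p = 1) :
    ContDiffAt ℝ 2 (fun q ↦ extChartAt I (1 : G) (f q)) p := by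
  have h1 : ContMDiffAt I 𝓘(ℝ, E) ∞ (extChartAt I (1 : G)) (f p) := by
    rw [h]; exact contMDiffAt_extChartAt
  exact ((h1.comp p hf).contDiffAt).of_le ENat.LEInfty.out

lemma chartMul_one_left [I.Boundaryless] : ∀ᶠ b in 𝓝 (extChartAt I (1 : G) 1),
    chartMul I G (extChartAt I (1 : G) 1, b) = b := by
  filter_upwards [extChartAt_target_mem_nhds (I := I) (1 : G)] with b hb
  simp only [chartMul, extChartAt_to_inv, one_mul]
  exact (extChartAt I (1 : G)).right_inv hb

lemma chartMul_one_right [I.Boundaryless] : ∀ᶠ b in 𝓝 (extChartAt I (1 : G) 1),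
    chartMul I G (b, extChartAt I (1 : G) 1) = b := by
  filter_upwards [extChartAt_target_mem_nhds (I := I) (1 : G)] with b hb
  simp only [chartMul, extChartAt_to_inv, mul_one]
  exact (extChartAt I (1 : G)).right_inv hb

variable [LieGroup I ∞ G] [I.Boundaryless]

lemma contMDiffAt_extChartAt_symm_comp {f : E × E → E} {p : E × E} (hf : ContDiffAt ℝ ∞ f p)
    (h : f p = extChartAt I (1 : G) 1) :
    ContMDiffAt 𝓘(ℝ, E × E) I ∞ (fun q ↦ (extChartAt I (1 : G)).symm (f q)) p := by
  have h1 : ContMDiffAt 𝓘(ℝ, E) I ∞ (extChartAt I (1 : G)).symm (f p) := by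
    rw [h]
    exact (contMDiffOn_extChartAt_symm (1 : G)).contMDiffAt (extChartAt_target_mem_nhds 1)
  exact h1.comp p hf.contMDiffAt

lemma contDiffAt_chartMul :
    ContDiffAt ℝ 2 (chartMul I G) (extChartAt I (1 : G) 1, extChartAt I (1 : G) 1) := by
  have h1 := contMDiffAt_extChartAt_symm_comp I G (p := (extChartAt I (1 : G) 1,
    extChartAt I (1 : G) 1)) contDiffAt_fst rfl
  have h2 := contMDiffAt_extChartAt_symm_comp I G (p := (extChartAt I (1 : G) 1,
    extChartAt I (1 : G) 1)) contDiffAt_snd rfl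
  exact contDiffAt_chart I G (h1.mul h2) (by simp)

lemma contDiffAt_chartConj :
    ContDiffAt ℝ 2 (chartConj I G) (extChartAt I (1 : G) 1, extChartAt I (1 : G) 1) := by
  have h1 := contMDiffAt_extChartAt_symm_comp I G (p := (extChartAt I (1 : G) 1,
    extChartAt I (1 : G) 1)) contDiffAt_fst rfl
  have h2 := contMDiffAt_extChartAt_symm_comp I G (p := (extChartAt I (1 : G) 1,
    extChartAt I (1 : G) 1)) contDiffAt_snd rfl
  exact contDiffAt_chart I G ((h1.mul h2).mul h1.inv) (by simp)

lemma chartMul_conj : ∀ᶠ p in 𝓝 (extChartAt I (1 : G) 1, extChartAt I (1 : G) 1),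
    chartMul I G (chartConj I G p, p.1) = chartMul I G p := by
  have h1 := contMDiffAt_extChartAt_symm_comp I G (p := (extChartAt I (1 : G) 1,
    extChartAt I (1 : G) 1)) contDiffAt_fst rfl
  have h2 := contMDiffAt_extChartAt_symm_comp I G (p := (extChartAt I (1 : G) 1,
    extChartAt I (1 : G) 1)) contDiffAt_snd rfl
  filter_upwards [eventually_extChartAt_one I G ((h1.mul h2).mul h1.inv).continuousAt (by simp)]
    with p hp
  simp only [Pi.mul_apply] at hp
  simp only [chartMul, chartConj]
  rw [(extChartAt I (1 : G)).left_inv hp]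
  simp

variable {I G}

lemma Ad_apply (x : G) (Y : GroupLieAlgebra I G) :
    Ad I x Y = fderiv ℝ (fun b ↦ extChartAt I (1 : G) (x * (extChartAt I (1 : G)).symm b * x⁻¹))
      (extChartAt I (1 : G) 1) Y := by
  have h : (show E →L[ℝ] E from mfderiv I I (fun y : G ↦ x * y * x⁻¹) 1) =
    fderiv ℝ (fun b ↦ extChartAt I (1 : G) (x * (extChartAt I (1 : G)).symm b * x⁻¹))
      (extChartAt I (1 : G) 1) := by
    refine (mdifferentiableAt_conj x 1).mfderiv.trans ?_
    change fderivWithin ℝ (writtenInExtChartAt I I 1 fun y ↦ x * y * x⁻¹) (range I)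
      (extChartAt I (1 : G) 1) = _
    rw [I.range_eq_univ, fderivWithin_univ]
    simp only [writtenInExtChartAt, mul_one, mul_inv_cancel]
    rfl
  exact congrArg (fun f : E →L[ℝ] E ↦ f Y) h

/-- In the chart, a left-invariant field is the partial derivative of the multiplication in its
second variable, so that brackets become second derivatives of `chartMul`. -/
lemma mpullback_mulInvariantVectorField_chart [CompleteSpace E] (X : GroupLieAlgebra I G) :
    ∀ᶠ a in 𝓝 (extChartAt I (1 : G) 1),
      mpullbackWithin 𝓘(ℝ, E) I (extChartAt I (1 : G)).symm
        (mulInvariantVectorField X : ∀ x : G, TangentSpace I x) (range I) a =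
      fderiv ℝ (fun b ↦ chartMul I G (a, b)) (extChartAt I (1 : G) 1) X := by
  filter_upwards [extChartAt_target_mem_nhds (I := I) (1 : G)] with a ha
  rw [mpullbackWithin_apply]
  have hinv := ContinuousLinearMap.inverse_eq
    (mfderivWithin_extChartAt_symm_comp_mfderiv_extChartAt (I := I) ha)
    (mfderiv_extChartAt_comp_mfderivWithin_extChartAt_symm ha)
  rw [hinv]
  set x : G := (extChartAt I (1 : G)).symm a with hx
  have hxs : x ∈ (chartAt H (1 : G)).source := by
    rw [← extChartAt_source (I := I)]; exact (extChartAt I (1 : G)).map_target ha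
  have e1 : (extChartAt I (1 : G)).symm (extChartAt I (1 : G) 1) = 1 := by simp
  have h1 : HasMFDerivAt 𝓘(ℝ, E) I (extChartAt I (1 : G)).symm (extChartAt I (1 : G) 1)
      (ContinuousLinearMap.id ℝ E) := by
    have := (mdifferentiableWithinAt_extChartAt_symm (I := I) (x := (1 : G))
      (mem_extChartAt_target 1)).hasMFDerivWithinAt
    rw [mfderivWithin_range_extChartAt_symm, I.range_eq_univ] at this
    exact hasMFDerivWithinAt_univ.1 this
  have h2 : HasMFDerivAt I I (fun y : G ↦ x * y) ((extChartAt I (1 : G)).symm (extChartAt I (1 : G) 1))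
      (mfderiv I I (fun y : G ↦ x * y) 1) := by
    rw [e1]; exact (mdifferentiableAt_mul_left x 1).hasMFDerivAt
  have h3 : HasMFDerivAt I 𝓘(ℝ, E) (extChartAt I (1 : G))
      (x * (extChartAt I (1 : G)).symm (extChartAt I (1 : G) 1))
      (mfderiv I 𝓘(ℝ, E) (extChartAt I (1 : G)) x) := by
    rw [e1, mul_one]; exact (mdifferentiableAt_extChartAt hxs).hasMFDerivAt
  have h4 := HasMFDerivAt.comp (f := fun b ↦ x * (extChartAt I (1 : G)).symm b)
    (extChartAt I (1 : G) 1) h3 (h2.comp _ h1)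
  let D₁ : E →L[ℝ] E := mfderiv I I (fun y : G ↦ x * y) 1
  let D₂ : E →L[ℝ] E := mfderiv I 𝓘(ℝ, E) (extChartAt I (1 : G)) x
  have h5 : HasFDerivAt (fun b ↦ chartMul I G (a, b))
      (D₂.comp (D₁.comp (ContinuousLinearMap.id ℝ E))) (extChartAt I (1 : G) 1) :=
    hasMFDerivAt_iff_hasFDerivAt.1 h4
  rw [h5.fderiv]
  rfl

lemma bracket_eq_fderiv [CompleteSpace E] (X Y : GroupLieAlgebra I G) :
    (⁅X, Y⁆ : GroupLieAlgebra I G) =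
      (fderiv ℝ (fun a ↦ fderiv ℝ (fun b ↦ chartMul I G (a, b)) (extChartAt I (1 : G) 1))
        (extChartAt I (1 : G) 1) X Y -
      fderiv ℝ (fun a ↦ fderiv ℝ (fun b ↦ chartMul I G (a, b)) (extChartAt I (1 : G) 1))
        (extChartAt I (1 : G) 1) Y X : E) := by
  obtain ⟨-, -, hL1, -⟩ := fderiv_fderiv_conj (contDiffAt_chartMul I G) (contDiffAt_chartConj I G)
    (Eventually.of_forall (chartConj_one I G)) (chartMul_conj I G) (chartMul_one_left I G)
    (chartMul_one_right I G)
  obtain ⟨hLd, -⟩ := ContDiffAt.hasFDerivAt_fderiv_prodMk_right (contDiffAt_chartMul I G)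
  rw [GroupLieAlgebra.bracket_def, ← mlieBracketWithin_univ, mlieBracketWithin_apply]
  refine (congrArg (fun f : E →L[ℝ] E ↦ f.inverse _) mfderiv_extChartAt_self).trans ?_
  refine (congrArg (fun f : E →L[ℝ] E ↦ f _) ContinuousLinearMap.inverse_id).trans ?_
  rw [ContinuousLinearMap.id_apply]
  simp only [I.range_eq_univ, preimage_univ, inter_univ]
  have h := fun X : GroupLieAlgebra I G ↦ mpullback_mulInvariantVectorField_chart (I := I) (G := G) X
  simp only [I.range_eq_univ] at h
  have h' := Filter.EventuallyEq.lieBracket_vectorField_eq (𝕜 := ℝ) (h X) (h Y)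
  refine (congrFun (lieBracketWithin_univ (𝕜 := ℝ)) _).trans (h'.trans ?_)
  rw [lieBracket_eq]
  have hf : ∀ Z : E, HasFDerivAt
      (fun a ↦ fderiv ℝ (fun b ↦ chartMul I G (a, b)) (extChartAt I (1 : G) 1) Z) _ _ :=
    fun Z ↦ hLd.hasFDerivAt.clm_apply (hasFDerivAt_const Z _)
  simp only
  erw [(hf X).fderiv, (hf Y).fderiv, hL1]
  simp only [ContinuousLinearMap.comp_zero, zero_add]
  rfl

end Chart

/-! ### Haar averaging of inner products. -/

section Averaging

open MeasureTheory

/-- A continuous finite-dimensional real representation of a compact group has an invariant inner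
product. -/
theorem exists_innerProduct_of_compactGroup {E : Type*} [NormedAddCommGroup E] [NormedSpace ℝ E]
    [FiniteDimensional ℝ E] {G : Type*} [Group G] [TopologicalSpace G] [IsTopologicalGroup G]
    [T2Space G] [CompactSpace G] (ρ : G → E →L[ℝ] E) (hρ : Continuous ρ)
    (hmul : ∀ x y, ρ (x * y) = (ρ x).comp (ρ y)) (hone : ρ 1 = ContinuousLinearMap.id ℝ E) :
    ∃ β : LinearMap.BilinForm ℝ E, IsInnerProduct β ∧ ∀ x Y Z, β (ρ x Y) (ρ x Z) = β Y Z := by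
  let _ : MeasurableSpace G := borel G
  have : BorelSpace G := ⟨rfl⟩
  let μ : Measure G := Measure.haar
  -- The inverse turns the action of `ρ y` on `Y` and `Z` into a left translation of `x`, under
  -- which Haar measure is invariant.
  let f : E → E → G → ℝ := fun Y Z x ↦
    inner ℝ (toEuclidean (ρ x⁻¹ Y)) (toEuclidean (ρ x⁻¹ Z))
  have hc : ∀ Y, Continuous fun x : G ↦ toEuclidean (ρ x⁻¹ Y) := fun Y ↦
    toEuclidean.continuous.comp ((hρ.comp continuous_inv).clm_apply continuous_const)
  have hf : ∀ Y Z, Continuous (f Y Z) := fun Y Z ↦ (hc Y).inner (hc Z)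
  have hi : ∀ Y Z, Integrable (f Y Z) μ := fun Y Z ↦
    (hf Y Z).integrable_of_hasCompactSupport (HasCompactSupport.of_compactSpace _)
  let β : LinearMap.BilinForm ℝ E := LinearMap.mk₂ ℝ (fun Y Z ↦ ∫ x, f Y Z x ∂μ)
    (fun Y Y' Z ↦ by
      rw [← integral_add (hi _ _) (hi _ _)]
      congr 1; ext x
      simp only [f, map_add, inner_add_left])
    (fun c Y Z ↦ by
      rw [smul_eq_mul, ← integral_const_mul]
      congr 1; ext x
      simp only [f, map_smul, real_inner_smul_left])
    (fun Y Z Z' ↦ by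
      rw [← integral_add (hi _ _) (hi _ _)]
      congr 1; ext x
      simp only [f, map_add, inner_add_right])
    (fun c Y Z ↦ by
      rw [smul_eq_mul, ← integral_const_mul]
      congr 1; ext x
      simp only [f, map_smul, real_inner_smul_right])
  have hβ : ∀ Y Z, β Y Z = ∫ x, f Y Z x ∂μ := fun Y Z ↦ rfl
  refine ⟨β, ⟨fun Y Z ↦ ?_, fun Y hY ↦ ?_⟩, fun y Y Z ↦ ?_⟩
  · rw [hβ, hβ]
    congr 1; ext x
    exact real_inner_comm _ _
  · rw [hβ]
    refine (hf Y Y).integral_pos_of_hasCompactSupport_nonneg_nonzero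
      (HasCompactSupport.of_compactSpace _) (fun x ↦ real_inner_self_nonneg) (x := 1) ?_
    simp only [f, inv_one, hone]
    simpa using hY
  · rw [hβ, hβ, ← integral_mul_left_eq_self (f Y Z) y⁻¹]
    congr 1; ext x
    have : ∀ W, ρ x⁻¹ (ρ y W) = ρ (y⁻¹ * x)⁻¹ W := fun W ↦ by
      rw [mul_inv_rev, inv_inv, hmul]; rfl
    simp only [f, this]

end Averaging

/-! ### The adjoint representation and its invariant inner product. -/

section Adjoint

open Filter Topology

variable {E : Type u} [NormedAddCommGroup E] [NormedSpace ℝ E]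
  {H : Type v} [TopologicalSpace H] {I : ModelWithCorners ℝ E H}
  {G : Type w} [TopologicalSpace G] [ChartedSpace H G] [Group G]

variable (I) in
/-- The adjoint action as a continuous linear map of the model space. -/
def adCLM (x : G) : E →L[ℝ] E := mfderiv I I (fun y : G ↦ x * y * x⁻¹) 1

lemma adCLM_one : adCLM I (1 : G) = ContinuousLinearMap.id ℝ E := by
  have h : mfderiv I I (fun y : G ↦ 1 * y * 1⁻¹) (1 : G) = ContinuousLinearMap.id ℝ E := by
    have e : (fun y : G ↦ 1 * y * 1⁻¹) = id := by ext; simp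
    rw [e]; exact mfderiv_id
  exact h

variable [LieGroup I ∞ G]

lemma adCLM_mul (x y : G) : adCLM I (x * y) = (adCLM I x).comp (adCLM I y) := by
  have e : (fun z : G ↦ x * y * z * (x * y)⁻¹) = (fun z : G ↦ x * z * x⁻¹) ∘
      (fun z : G ↦ y * z * y⁻¹) := by ext; simp [mul_assoc]
  have h1 : HasMFDerivAt I I (fun z : G ↦ y * z * y⁻¹) 1
      (mfderiv I I (fun z : G ↦ y * z * y⁻¹) 1) :=
    (mdifferentiableAt_conj y 1).hasMFDerivAt
  have h2 : HasMFDerivAt I I (fun z : G ↦ x * z * x⁻¹) (y * 1 * y⁻¹)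
      (mfderiv I I (fun z : G ↦ x * z * x⁻¹) 1) := by
    have e1 : y * 1 * y⁻¹ = 1 := by simp
    rw [e1]; exact (mdifferentiableAt_conj x 1).hasMFDerivAt
  have h3 := HasMFDerivAt.comp (f := fun z : G ↦ y * z * y⁻¹) (1 : G) h2 h1
  rw [← e] at h3
  exact h3.mfderiv

variable [I.Boundaryless]

lemma adCLM_eq (x : G) : adCLM I x =
    fderiv ℝ (fun b ↦ extChartAt I (1 : G) (x * (extChartAt I (1 : G)).symm b * x⁻¹))
      (extChartAt I (1 : G) 1) := by
  ext Y
  exact Ad_apply x Y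

/-- The derivative of the adjoint action, read in a chart, is the bracket. -/
lemma adCLM_chart [CompleteSpace E] :
    DifferentiableAt ℝ (fun a ↦ adCLM I ((extChartAt I (1 : G)).symm a)) (extChartAt I (1 : G) 1) ∧
    ∀ X Y : GroupLieAlgebra I G, fderiv ℝ (fun a ↦ adCLM I ((extChartAt I (1 : G)).symm a))
      (extChartAt I (1 : G) 1) X Y = (⁅X, Y⁆ : GroupLieAlgebra I G) := by
  obtain ⟨h1, -, -, h2⟩ := fderiv_fderiv_conj (contDiffAt_chartMul I G) (contDiffAt_chartConj I G)
    (Eventually.of_forall (chartConj_one I G)) (chartMul_conj I G) (chartMul_one_left I G)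
    (chartMul_one_right I G)
  have e : (fun a ↦ adCLM I ((extChartAt I (1 : G)).symm a)) =
      fun a ↦ fderiv ℝ (fun b ↦ chartConj I G (a, b)) (extChartAt I (1 : G) 1) := by
    funext a; rw [adCLM_eq]; rfl
  rw [e]
  exact ⟨h1, fun X Y ↦ (h2 X Y).trans (bracket_eq_fderiv X Y).symm⟩

lemma continuous_adCLM [CompleteSpace E] : Continuous (adCLM I : G → E →L[ℝ] E) := by
  have : IsTopologicalGroup G := topologicalGroup_of_lieGroup I ∞
  have h1 : ContinuousAt (adCLM I : G → E →L[ℝ] E) 1 := by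
    have h2 : ContinuousAt ((fun a ↦ adCLM I ((extChartAt I (1 : G)).symm a)) ∘
        extChartAt I (1 : G)) 1 :=
      ContinuousAt.comp (adCLM_chart (I := I) (G := G)).1.continuousAt (continuousAt_extChartAt 1)
    refine h2.congr ?_
    filter_upwards [extChartAt_source_mem_nhds (I := I) (1 : G)] with x hx
    simp only [Function.comp_apply, (extChartAt I (1 : G)).left_inv hx]
  rw [continuous_iff_continuousAt]
  intro x
  -- Multiplicativity carries continuity from `1` to every point.
  have e : (adCLM I : G → E →L[ℝ] E) = fun y ↦ (adCLM I x).comp (adCLM I (x⁻¹ * y)) := by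
    funext y; rw [← adCLM_mul, mul_inv_cancel_left]
  rw [e]
  have h3 : ContinuousAt (fun y ↦ adCLM I (x⁻¹ * y)) x := by
    rw [← inv_mul_cancel x] at h1
    exact ContinuousAt.comp (f := fun y ↦ x⁻¹ * y) h1
      (continuous_const.mul continuous_id).continuousAt
  exact continuousAt_const.clm_comp h3

/-- The Lie algebra of a compact Lie group has an invariant inner product. -/
theorem exists_lieInvariant_innerProduct [FiniteDimensional ℝ E] [CompleteSpace E] [T2Space G]
    [CompactSpace G] :
    ∃ β : LinearMap.BilinForm ℝ (GroupLieAlgebra I G), IsInnerProduct β ∧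
      ∀ X Y Z : GroupLieAlgebra I G, β ⁅X, Y⁆ Z + β Y ⁅X, Z⁆ = 0 := by
  have : IsTopologicalGroup G := topologicalGroup_of_lieGroup I ∞
  obtain ⟨β, hβ, hinv⟩ := exists_innerProduct_of_compactGroup (adCLM I : G → E →L[ℝ] E)
    continuous_adCLM adCLM_mul adCLM_one
  refine ⟨β, ⟨hβ.symm, hβ.pos⟩, fun X Y Z ↦ ?_⟩
  obtain ⟨hd, hbr⟩ := adCLM_chart (I := I) (G := G)
  set A : E → E →L[ℝ] E := fun a ↦ adCLM I ((extChartAt I (1 : G)).symm a)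
  have hA1 : A (extChartAt I (1 : G) 1) = ContinuousLinearMap.id ℝ E := by
    simp only [A, extChartAt_to_inv, adCLM_one]
  let b : E →L[ℝ] E →L[ℝ] ℝ := LinearMap.toContinuousBilinearMap β
  have hY := fun W : E ↦ hd.hasFDerivAt.clm_apply (hasFDerivAt_const W (extChartAt I (1 : G) 1))
  have h1 := (b.hasFDerivAt.comp (extChartAt I (1 : G) 1) (hY Y)).clm_apply (hY Z)
  -- Invariance under `Ad` makes this function constant; its derivative by the product rule is the
  -- required bracket identity.
  have h2 : HasFDerivAt (fun a ↦ b (A a Y) (A a Z)) (0 : E →L[ℝ] ℝ) (extChartAt I (1 : G) 1) := by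
    have e : (fun a ↦ b (A a Y) (A a Z)) = fun _ ↦ β Y Z := by
      funext a; exact hinv _ Y Z
    rw [e]; exact hasFDerivAt_const _ _
  have h3 := congrArg (fun f : E →L[ℝ] ℝ ↦ f X) (h1.unique h2)
  have h4 : β (A (extChartAt I (1 : G) 1) Y) (fderiv ℝ A (extChartAt I (1 : G) 1) X Z) +
    β (fderiv ℝ A (extChartAt I (1 : G) 1) X Y) (A (extChartAt I (1 : G) 1) Z) = 0 := by
    simpa using! h3
  rw [hA1, hbr, hbr] at h4
  rw [add_comm]
  exact h4

end Adjoint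

/-! ### Linear algebra of inner products and orthonormal bases. -/

section InnerProduct

open Module

variable {V : Type*} [AddCommGroup V] [Module ℝ V]

lemma IsInnerProduct.self_nonneg {Q : LinearMap.BilinForm ℝ V} (hQ : IsInnerProduct Q) (x : V) :
    0 ≤ Q x x := by
  rcases eq_or_ne x 0 with rfl | h
  · simp
  · exact (hQ.pos x h).le

lemma IsInnerProduct.eq_zero {Q : LinearMap.BilinForm ℝ V} (hQ : IsInnerProduct Q) {x : V}
    (h : Q x x = 0) : x = 0 := by
  by_contra hx
  exact (hQ.pos x hx).ne' h

lemma IsInnerProduct.nondegenerate {Q : LinearMap.BilinForm ℝ V} (hQ : IsInnerProduct Q) :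
    Q.Nondegenerate :=
  ⟨fun x h ↦ hQ.eq_zero (h x), fun x h ↦ hQ.eq_zero (h x)⟩

lemma IsInnerProduct.restrict {Q : LinearMap.BilinForm ℝ V} (hQ : IsInnerProduct Q)
    {W : Type*} [AddCommGroup W] [Module ℝ W] (f : W →ₗ[ℝ] V) (hf : Function.Injective f) :
    IsInnerProduct (Q.compl₁₂ f f) :=
  ⟨fun x y ↦ hQ.symm _ _, fun x hx ↦ hQ.pos _ fun h ↦ hx (hf (by rw [h, map_zero]))⟩

lemma IsInnerProduct.exists_represent [FiniteDimensional ℝ V] {Q : LinearMap.BilinForm ℝ V}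
    (hQ : IsInnerProduct Q) (φ : V →ₗ[ℝ] ℝ) : ∃ x, ∀ y, Q x y = φ y :=
  ⟨(LinearMap.BilinForm.toDual Q hQ.nondegenerate).symm φ, fun y ↦
    LinearMap.BilinForm.apply_toDual_symm_apply (hB := hQ.nondegenerate) φ y⟩

/-- Orthogonal projection to a subspace. -/
lemma IsInnerProduct.exists_proj [FiniteDimensional ℝ V] {Q : LinearMap.BilinForm ℝ V}
    (hQ : IsInnerProduct Q) (W : Submodule ℝ V) (x : V) :
    ∃ w ∈ W, ∀ y ∈ W, Q (x - w) y = 0 := by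
  obtain ⟨w, hw⟩ := (hQ.restrict W.subtype W.injective_subtype).exists_represent
    ((Q x).comp W.subtype)
  refine ⟨w, w.2, fun y hy ↦ ?_⟩
  have := hw ⟨y, hy⟩
  simp only [LinearMap.compl₁₂_apply, Submodule.subtype_apply, LinearMap.comp_apply] at this
  rw [map_sub, LinearMap.sub_apply, this, sub_self]

/-- A symmetric bilinear form is diagonal in an orthonormal basis. -/
theorem IsInnerProduct.exists_basis [FiniteDimensional ℝ V] {Q g : LinearMap.BilinForm ℝ V}
    (hQ : IsInnerProduct Q) (hg : ∀ x y, g x y = g y x) :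
    ∃ (b : Basis (Fin (finrank ℝ V)) ℝ V) (p : Fin (finrank ℝ V) → ℝ),
      (∀ i j, Q (b i) (b j) = if i = j then 1 else 0) ∧
      ∀ i j, g (b i) (b j) = if i = j then p i else 0 := by
  let core : InnerProductSpace.Core ℝ V :=
    { inner := fun x y ↦ Q x y
      conj_inner_symm := fun x y ↦ by simp [hQ.symm x y]
      re_inner_nonneg := fun x ↦ by simpa using hQ.self_nonneg x
      add_left := fun x y z ↦ by simp
      smul_left := fun x y r ↦ by simp
      definite := fun x h ↦ hQ.eq_zero h }
  let _ : NormedAddCommGroup V := core.toNormedAddCommGroup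
  let _ : InnerProductSpace ℝ V := InnerProductSpace.ofCore core.toCore
  -- The operator representing `g` with respect to `Q` is self-adjoint, so the spectral theorem
  -- applies.
  let T : V →ₗ[ℝ] V := (LinearMap.BilinForm.toDual Q hQ.nondegenerate).symm.toLinearMap ∘ₗ g
  have hT : ∀ x y, Q (T x) y = g x y := fun x y ↦
    LinearMap.BilinForm.apply_toDual_symm_apply (hB := hQ.nondegenerate) (g x) y
  have hin : ∀ x y : V, inner ℝ x y = Q x y := fun x y ↦ rfl
  have hTs : T.IsSymmetric := fun x y ↦ by
    rw [hin, hin, hT, hQ.symm, hT, hg]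
  let b := hTs.eigenvectorBasis rfl
  have hb : ∀ i j, Q (b i) (b j) = if i = j then 1 else 0 := fun i j ↦ by
    rw [← hin]; exact orthonormal_iff_ite.1 b.orthonormal i j
  refine ⟨b.toBasis, hTs.eigenvalues rfl, fun i j ↦ ?_, fun i j ↦ ?_⟩
  · simpa using! hb i j
  · have h : T (b i) = (hTs.eigenvalues rfl i) • b i := hTs.apply_eigenvectorBasis rfl i
    have h2 : g (b i) (b j) = if i = j then hTs.eigenvalues rfl i else 0 := by
      rw [← hT, h, map_smul, LinearMap.smul_apply, hb, smul_eq_mul, mul_ite, mul_one, mul_zero]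
    simpa using! h2

variable {ι : Type*} [Fintype ι] [DecidableEq ι]

lemma repr_eq_of_orthonormal {Q : LinearMap.BilinForm ℝ V} {b : Basis ι ℝ V}
    (hb : ∀ i j, Q (b i) (b j) = if i = j then 1 else 0) (x : V) (i : ι) :
    b.repr x i = Q (b i) x := by
  conv_rhs => rw [← b.sum_repr x, map_sum]
  simp only [map_smul, hb, smul_eq_mul, mul_ite, mul_one, mul_zero, Finset.sum_ite_eq,
    Finset.mem_univ, if_true]

lemma trace_eq_sum_of_orthonormal {Q : LinearMap.BilinForm ℝ V} {b : Basis ι ℝ V}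
    (hb : ∀ i j, Q (b i) (b j) = if i = j then 1 else 0) (f : V →ₗ[ℝ] V) :
    LinearMap.trace ℝ V f = ∑ i, Q (b i) (f (b i)) := by
  rw [LinearMap.trace_eq_matrix_trace ℝ b]
  simp only [Matrix.trace, Matrix.diag_apply, LinearMap.toMatrix_apply,
    repr_eq_of_orthonormal hb]

lemma apply_eq_sum_of_orthonormal {Q : LinearMap.BilinForm ℝ V} {b : Basis ι ℝ V}
    (hb : ∀ i j, Q (b i) (b j) = if i = j then 1 else 0) (B : LinearMap.BilinForm ℝ V) (x y : V) :
    B x y = ∑ i, Q (b i) y * B x (b i) := by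
  conv_lhs => rw [← b.sum_repr y]
  simp [repr_eq_of_orthonormal hb]

/-- An orthonormal family with trivial orthogonal complement is a basis. -/
lemma IsInnerProduct.exists_basis_of_orthonormal {Q : LinearMap.BilinForm ℝ V} {e : ι → V}
    (he : ∀ i j, Q (e i) (e j) = if i = j then 1 else 0)
    (hc : ∀ x, (∀ i, Q (e i) x = 0) → x = 0) : ∃ b : Basis ι ℝ V, ∀ i, b i = e i := by
  have hli : LinearIndependent ℝ e := by
    rw [Fintype.linearIndependent_iff]
    intro a ha i
    have := congrArg (Q (e i)) ha
    simpa [he] using this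
  have hsp : ⊤ ≤ Submodule.span ℝ (Set.range e) := by
    intro x _
    have h0 : x - ∑ j, Q (e j) x • e j = 0 := hc _ fun i ↦ by simp [he]
    rw [sub_eq_zero.1 h0]
    exact Submodule.sum_mem _ fun j _ ↦ Submodule.smul_mem _ _ (Submodule.subset_span ⟨j, rfl⟩)
  exact ⟨Basis.mk hli hsp, fun i ↦ by simp⟩

end InnerProduct

/-! ### Invariant forms, structure constants and the Ricci formula. -/

section LieAlgebra

open Module

variable {L : Type*} [LieRing L] [LieAlgebra ℝ L]

lemma neg_killingForm_symm (x y : L) : (-killingForm ℝ L) x y = (-killingForm ℝ L) y x := by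
  simp only [LinearMap.neg_apply]
  rw [LieModule.traceForm_comm]

lemma neg_killingForm_lie (x y z : L) :
    (-killingForm ℝ L) ⁅x, y⁆ z = (-killingForm ℝ L) x ⁅y, z⁆ := by
  simp only [LinearMap.neg_apply]
  rw [LieModule.traceForm_apply_lie_apply]

/-- If a Lie algebra with trivial centre has an invariant inner product, then its Killing form is
negative definite. -/
theorem isInnerProduct_neg_killingForm [FiniteDimensional ℝ L] {β : LinearMap.BilinForm ℝ L}
    (hβ : IsInnerProduct β) (hinv : ∀ X Y Z : L, β ⁅X, Y⁆ Z + β Y ⁅X, Z⁆ = 0)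
    (hL : ∀ X : L, (∀ Y : L, ⁅X, Y⁆ = 0) → X = 0) : IsInnerProduct (-killingForm ℝ L) := by
  refine ⟨neg_killingForm_symm, fun X hX ↦ ?_⟩
  obtain ⟨b, -, hb, -⟩ := hβ.exists_basis hβ.symm
  -- Since `ad X` is `β`-skew, `-tr (ad X)²` is the squared norm of `ad X`.
  have h1 : (-killingForm ℝ L) X X = ∑ i, β ⁅X, b i⁆ ⁅X, b i⁆ := by
    rw [LinearMap.neg_apply, LinearMap.neg_apply, killingForm_apply_apply,
      trace_eq_sum_of_orthonormal hb, ← Finset.sum_neg_distrib]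
    refine Finset.sum_congr rfl fun i _ ↦ ?_
    have := hinv X (b i) ⁅X, b i⁆
    simp only [LinearMap.comp_apply, LieAlgebra.ad_apply]
    linarith
  rw [h1]
  refine lt_of_le_of_ne (Finset.sum_nonneg fun i _ ↦ hβ.self_nonneg _) fun h0 ↦ hX (hL X ?_)
  have h2 : ∀ i, ⁅X, b i⁆ = 0 := fun i ↦ hβ.eq_zero
    ((Finset.sum_eq_zero_iff_of_nonneg fun i _ ↦ hβ.self_nonneg _).1 h0.symm i (Finset.mem_univ i))
  have h3 : (LieAlgebra.ad ℝ L X : L →ₗ[ℝ] L) = 0 := b.ext fun i ↦ by simpa using h2 i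
  intro Y
  simpa using LinearMap.congr_fun h3 Y

lemma IsSimple.eq_zero_of_central (h : LieAlgebra.IsSimple ℝ L) (X : L)
    (hX : ∀ Y : L, ⁅X, Y⁆ = 0) : X = 0 := by
  have hc : LieAlgebra.center ℝ L = ⊥ := by
    rcases h.eq_bot_or_eq_top (LieAlgebra.center ℝ L) with h1 | h1
    · exact h1
    · refine absurd ((LieAlgebra.isLieAbelian_iff_center_eq_top ℝ L).2 h1) h.non_abelian
  have : X ∈ LieAlgebra.center ℝ L := by
    rw [LieModule.mem_maxTrivSubmodule]
    intro Y
    rw [← lie_skew, hX, neg_zero]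
  rw [hc] at this
  simpa using this

variable {ι : Type*}

/-- The structure constants of `L` with respect to a basis and a bilinear form. -/
def structureConstant (Q : LinearMap.BilinForm ℝ L) (e : ι → L) (i j k : ι) : ℝ :=
  Q ⁅e i, e j⁆ (e k)

lemma structureConstant_swap (Q : LinearMap.BilinForm ℝ L) (e : ι → L) (i j k : ι) :
    structureConstant Q e j i k = - structureConstant Q e i j k := by
  simp only [structureConstant]
  rw [← lie_skew, map_neg, LinearMap.neg_apply]

lemma structureConstant_cycle {Q : LinearMap.BilinForm ℝ L} (hs : ∀ x y, Q x y = Q y x)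
    (hi : ∀ x y z, Q ⁅x, y⁆ z = Q x ⁅y, z⁆) (e : ι → L) (i j k : ι) :
    structureConstant Q e j k i = structureConstant Q e i j k := by
  simp only [structureConstant]
  rw [hi (e i), hs]

variable [Fintype ι] [DecidableEq ι]

/-- `tr (X ↦ R(X, v) v) = -tr (X ↦ ∇_X v)²` for the invariant connection `Γ`. -/
lemma trace_ricci {g : LinearMap.BilinForm ℝ L} {b : Basis ι ℝ L} {Q : LinearMap.BilinForm ℝ L}
    (hQi : ∀ x y z, Q ⁅x, y⁆ z = Q x ⁅y, z⁆)
    (hb : ∀ i j, Q (b i) (b j) = if i = j then 1 else 0) {p : ι → ℝ} (hp : ∀ i, 0 < p i)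
    (hgs : ∀ x y, g x y = g y x)
    (hg : ∀ i j, g (b i) (b j) = if i = j then p i else 0) {Γ : L →ₗ[ℝ] L →ₗ[ℝ] L}
    (hskew : ∀ X Y Z, g (Γ X Y) Z + g Y (Γ X Z) = 0) (htor : ∀ X Y, Γ X Y - Γ Y X = ⁅X, Y⁆)
    {v : L} {Ric : L →ₗ[ℝ] L} (hRic : ∀ w, Ric w = Γ w (Γ v v) - Γ v (Γ w v) - Γ ⁅w, v⁆ v) :
    LinearMap.trace ℝ L Ric = - LinearMap.trace ℝ L (Γ.flip v ∘ₗ Γ.flip v) := by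
  have hgQ : ∀ i x, g (b i) x = p i * Q (b i) x := fun i x ↦ by
    rw [apply_eq_sum_of_orthonormal hb g]
    simp [hg, mul_comm]
  have htr1 : ∀ u, LinearMap.trace ℝ L (Γ u) = 0 := fun u ↦ by
    rw [trace_eq_sum_of_orthonormal hb]
    refine Finset.sum_eq_zero fun i _ ↦ ?_
    have h1 := hskew u (b i) (b i)
    rw [hgs (Γ u (b i)), hgQ] at h1
    have h2 := hp i
    have h3 : p i * Q (b i) (Γ u (b i)) = 0 := by linarith
    exact (mul_eq_zero.1 h3).resolve_left h2.ne'
  have htr2 : ∀ u, LinearMap.trace ℝ L (Γ.flip u) = 0 := fun u ↦ by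
    have h1 : Γ.flip u = Γ u - (LieAlgebra.ad ℝ L u : L →ₗ[ℝ] L) := by
      ext w
      simp only [LinearMap.flip_apply, LinearMap.sub_apply, LieAlgebra.ad_apply]
      rw [← htor u w]; abel
    rw [h1, map_sub, htr1, zero_sub, neg_eq_zero, trace_eq_sum_of_orthonormal hb]
    refine Finset.sum_eq_zero fun i _ ↦ ?_
    rw [LieAlgebra.ad_apply, ← lie_skew, map_neg, ← hQi, lie_self]
    simp
  -- Write `⁅w, v⁆ = Γ w v - Γ v w`. The first summand has trace `0` and the two mixed products have
  -- equal traces with opposite signs.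
  have h1 : Ric = Γ.flip (Γ v v) - Γ v ∘ₗ Γ.flip v - Γ.flip v ∘ₗ Γ.flip v
      + Γ.flip v ∘ₗ Γ v := by
    ext w
    rw [hRic, ← htor w v]
    simp only [LinearMap.flip_apply, LinearMap.sub_apply, LinearMap.add_apply,
      LinearMap.comp_apply, map_sub]
    abel
  have : Module.Finite ℝ L := Module.Finite.of_basis b
  rw [h1, map_add, map_sub, map_sub, htr2, LinearMap.trace_comp_comm']
  ring

/-- The Ricci curvature of a left-invariant metric in an orthonormal basis of an invariant form `Q`
in which the metric is diagonal. -/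
theorem trace_ricci_basis {g : LinearMap.BilinForm ℝ L} {b : Basis ι ℝ L}
    {Q : LinearMap.BilinForm ℝ L}
    (hQs : ∀ x y, Q x y = Q y x) (hQi : ∀ x y z, Q ⁅x, y⁆ z = Q x ⁅y, z⁆)
    (hb : ∀ i j, Q (b i) (b j) = if i = j then 1 else 0) {p : ι → ℝ} (hp : ∀ i, 0 < p i)
    (hgs : ∀ x y, g x y = g y x)
    (hg : ∀ i j, g (b i) (b j) = if i = j then p i else 0) {Γ : L →ₗ[ℝ] L →ₗ[ℝ] L}
    (hskew : ∀ X Y Z, g (Γ X Y) Z + g Y (Γ X Z) = 0) (htor : ∀ X Y, Γ X Y - Γ Y X = ⁅X, Y⁆)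
    {v : ι} {Ric : L →ₗ[ℝ] L}
    (hRic : ∀ w, Ric w = Γ w (Γ (b v) (b v)) - Γ (b v) (Γ w (b v)) - Γ ⁅w, b v⁆ (b v)) :
    LinearMap.trace ℝ L Ric = ∑ i, ∑ j, structureConstant Q b v i j ^ 2 *
      (p v ^ 2 - (p i - p j) ^ 2) / (4 * (p i * p j)) := by
  have hgQ : ∀ i x, g (b i) x = p i * Q (b i) x := fun i x ↦ by
    rw [apply_eq_sum_of_orthonormal hb g]
    simp [hg, mul_comm]
  have hcyc := structureConstant_cycle hQs hQi b
  -- Koszul formula; the cyclic symmetry of the structure constants reduces its three terms to one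
  -- constant.
  have hkoszul : ∀ i j, 2 * (p j * Q (b j) (Γ (b i) (b v))) =
      structureConstant Q b v i j * (p i - p j - p v) := fun i j ↦ by
    have e : ∀ i j k, g ⁅b i, b j⁆ (b k) = p k * structureConstant Q b i j k := fun i j k ↦ by
      rw [hgs, hgQ, hQs]; rfl
    have h1 : 2 * g (Γ (b i) (b v)) (b j) =
        g ⁅b i, b v⁆ (b j) - g ⁅b v, b j⁆ (b i) + g ⁅b j, b i⁆ (b v) := by
      rw [← htor, ← htor, ← htor]
      simp only [map_sub, LinearMap.sub_apply]
      have t1 := hskew (b i) (b v) (b j)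
      have t2 := hskew (b v) (b i) (b j)
      have t3 := hskew (b j) (b i) (b v)
      rw [hgs (b v)] at t1
      rw [hgs (b i)] at t2 t3
      linarith
    rw [e, e, e, hgs, hgQ] at h1
    rw [h1]
    have s1 := structureConstant_swap Q b v i j
    have s2 := hcyc i v j
    have s3 := hcyc j i v
    have s4 := hcyc i v j
    rw [s1] at s2
    rw [← s3, s1, s2]
    ring
  have hQΓ : ∀ i j, Q (b j) (Γ (b i) (b v)) =
      structureConstant Q b v i j * (p i - p j - p v) / (2 * p j) := fun i j ↦ by
    rw [eq_div_iff (by have := hp j; positivity), ← hkoszul]; ring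
  rw [trace_ricci hQi hb hp hgs hg hskew htor hRic, trace_eq_sum_of_orthonormal hb,
    ← Finset.sum_neg_distrib]
  refine Finset.sum_congr rfl fun i _ ↦ ?_
  have h1 : Q (b i) ((Γ.flip (b v) ∘ₗ Γ.flip (b v)) (b i)) =
      ∑ j, Q (b j) (Γ (b i) (b v)) * Q (b i) (Γ (b j) (b v)) := by
    have := apply_eq_sum_of_orthonormal hb (Q.compl₂ (Γ.flip (b v))) (b i) (Γ (b i) (b v))
    simpa using this
  rw [h1, ← Finset.sum_neg_distrib]
  refine Finset.sum_congr rfl fun j _ ↦ ?_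
  have h3 : structureConstant Q b v j i = - structureConstant Q b v i j := by
    rw [← hcyc v j i, structureConstant_swap, hcyc v i j]
  rw [hQΓ, hQΓ, h3]
  have := (hp i).ne'
  have := (hp j).ne'
  field_simp
  ring

end LieAlgebra

/-! ### Sums of Ricci curvatures in terms of squared structure constants. -/

section Counting

variable {α κ : Type*} [Fintype α] [Fintype κ] {s : α ⊕ κ → α ⊕ κ → α ⊕ κ → ℝ} {p : α ⊕ κ → ℝ}

/-- The contribution of `α` to the sum of the squared structure constants with first index `x`. -/
def normalPart (s : α ⊕ κ → α ⊕ κ → α ⊕ κ → ℝ) (x : κ) : ℝ :=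
  ∑ a, ∑ a', s (.inr x) (.inl a) (.inl a')

/-- Let `A` be the sum of `s` with all indices in `α`, and `W` that of `normalPart`. Then the
cardinality of `α` is `A + 2W`, the Ricci sum is at most `A/4 + W`, and this is the bound. -/
lemma sum_ricci_normal_le (hs : ∀ i j k, 0 ≤ s i j k) (hswap : ∀ i j k, s j i k = s i j k)
    (hcyc : ∀ i j k, s j k i = s i j k) (hsum : ∀ i, ∑ j, ∑ k, s i j k = 1)
    (hsub : ∀ x y a, s (.inr x) (.inr y) (.inl a) = 0) (hp : ∀ i, 0 < p i) {q : ℝ}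
    (hq : ∀ a, p (.inl a) = q) (hqpos : 0 < q) :
    ∑ a, ∑ i, ∑ j, s (.inl a) i j * (p (.inl a) ^ 2 - (p i - p j) ^ 2) / (4 * (p i * p j)) ≤
      (2 * ∑ x, normalPart s x + Fintype.card α) / 4 := by
  have hsub' : ∀ a x y, s (.inl a) (.inr x) (.inr y) = 0 := fun a x y ↦ by
    rw [← hcyc, hsub]
  have hax : ∀ a a' x, s (.inl a) (.inl a') (.inr x) = s (.inr x) (.inl a) (.inl a') :=
    fun a a' x ↦ hcyc _ _ _
  have hxa : ∀ a x a', s (.inl a) (.inr x) (.inl a') = s (.inr x) (.inl a) (.inl a') :=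
    fun a x a' ↦ hswap _ _ _
  have hW : ∑ a, ∑ a', ∑ x, s (.inr x) (.inl a) (.inl a') = ∑ x, normalPart s x := by
    simp only [normalPart]
    rw [Finset.sum_comm]
    rw [Finset.sum_comm]
    rw [Finset.sum_congr rfl fun a _ ↦ Finset.sum_comm]
    rw [Finset.sum_comm]
  have hW' : ∑ a, ∑ x, ∑ a', s (.inr x) (.inl a) (.inl a') = ∑ x, normalPart s x := by
    simp only [normalPart]
    rw [Finset.sum_comm]
  have hcard : (Fintype.card α : ℝ) =
      ∑ a, ∑ a', ∑ a'', s (.inl a) (.inl a') (.inl a'') + 2 * ∑ x, normalPart s x := by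
    have h1 : (Fintype.card α : ℝ) = ∑ a, ∑ j, ∑ k, s (.inl a) j k := by
      rw [Finset.sum_congr rfl fun a _ ↦ hsum (.inl a)]
      simp
    rw [h1]
    simp only [Fintype.sum_sum_type, hax, hxa, hsub', Finset.sum_add_distrib, hW, hW']
    simp
    ring
  -- The coefficient equals `1/2 - p/(4q)`, where `p` is the weight of `x`.
  have hterm : ∀ a x a', s (.inr x) (.inl a) (.inl a') * (q ^ 2 - (q - p (.inr x)) ^ 2) /
      (4 * (q * p (.inr x))) ≤ s (.inr x) (.inl a) (.inl a') / 2 := fun a x a' ↦ by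
    have h1 := hp (.inr x)
    have h2 := hs (.inr x) (.inl a) (.inl a')
    rw [div_le_div_iff₀ (by positivity) (by norm_num)]
    nlinarith [mul_nonneg h2 (sq_nonneg (p (.inr x)))]
  have hle : ∑ a, ∑ i, ∑ j, s (.inl a) i j * (p (.inl a) ^ 2 - (p i - p j) ^ 2) /
      (4 * (p i * p j)) ≤
      ∑ a, ((∑ a', ∑ a'', s (.inl a) (.inl a') (.inl a'') / 4 +
        ∑ x, ∑ a', s (.inr x) (.inl a) (.inl a') / 2) +
        ∑ a', ∑ x, s (.inr x) (.inl a) (.inl a') / 2) := by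
    refine Finset.sum_le_sum fun a _ ↦ ?_
    simp only [Fintype.sum_sum_type, hax, hxa, hsub', Finset.sum_add_distrib, hq]
    simp only [zero_mul, zero_div, Finset.sum_const_zero, add_zero]
    refine add_le_add (add_le_add ?_ ?_) ?_
    · refine Finset.sum_le_sum fun a' _ ↦ Finset.sum_le_sum fun a'' _ ↦ le_of_eq ?_
      field_simp
      ring
    · refine Finset.sum_le_sum fun x _ ↦ Finset.sum_le_sum fun a' _ ↦ ?_
      refine le_trans (le_of_eq ?_) (hterm a x a')
      rw [mul_comm q]; ring
    · exact Finset.sum_le_sum fun a' _ ↦ Finset.sum_le_sum fun x _ ↦ hterm a x a'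
  refine hle.trans (le_of_eq ?_)
  simp only [Finset.sum_add_distrib, ← Finset.sum_div, hW, hW']
  rw [hcard]
  ring

/-- Within `κ`, all weights in a nonzero term agree, so its coefficient is `1/4`. For two indices in
`α` the difference of weights vanishes, leaving a quarter of the squared ratio. -/
lemma ricci_isotropy_eq (hcyc : ∀ i j k, s j k i = s i j k)
    (hsub : ∀ x y a, s (.inr x) (.inr y) (.inl a) = 0) (hp : ∀ i, 0 < p i) {q : ℝ}
    (hq : ∀ a, p (.inl a) = q) {x : κ}
    (hx : ∀ y y', s (.inr x) (.inr y) (.inr y') ≠ 0 → p (.inr y) = p (.inr x) ∧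
      p (.inr y') = p (.inr x)) :
    ∑ i, ∑ j, s (.inr x) i j * (p (.inr x) ^ 2 - (p i - p j) ^ 2) / (4 * (p i * p j)) =
      (∑ y, ∑ y', s (.inr x) (.inr y) (.inr y') + normalPart s x * (p (.inr x) / q) ^ 2) / 4 := by
  have hsub' : ∀ a y, s (.inr x) (.inl a) (.inr y) = 0 := fun a y ↦
    (hcyc _ _ _).trans (hsub _ _ _)
  have hterm : ∀ y y', s (.inr x) (.inr y) (.inr y') * (p (.inr x) ^ 2 - (p (.inr y) -
      p (.inr y')) ^ 2) / (4 * (p (.inr y) * p (.inr y'))) =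
      s (.inr x) (.inr y) (.inr y') / 4 := fun y y' ↦ by
    by_cases h : s (.inr x) (.inr y) (.inr y') = 0
    · simp [h]
    · obtain ⟨h1, h2⟩ := hx y y' h
      have := (hp (.inr x)).ne'
      rw [h1, h2]
      field_simp
      ring
  simp only [Fintype.sum_sum_type, hsub, hsub', Finset.sum_add_distrib, hq, hterm, sub_self]
  simp only [zero_mul, zero_div, Finset.sum_const_zero, add_zero, zero_add, normalPart,
    Finset.sum_mul, Finset.sum_div, add_div]
  rw [add_comm]
  refine congrArg₂ _ rfl (Finset.sum_congr rfl fun a _ ↦ Finset.sum_congr rfl fun a' _ ↦ ?_)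
  have := (hp (.inl a)).ne'
  rw [hq] at this
  field_simp
  ring

lemma normalPart_eq (hcyc : ∀ i j k, s j k i = s i j k)
    (hsum : ∀ i, ∑ j, ∑ k, s i j k = 1)
    (hsub : ∀ x y a, s (.inr x) (.inr y) (.inl a) = 0) (x : κ) :
    normalPart s x = 1 - ∑ y, ∑ y', s (.inr x) (.inr y) (.inr y') := by
  have hsub' : ∀ a y, s (.inr x) (.inl a) (.inr y) = 0 := fun a y ↦
    (hcyc _ _ _).trans (hsub _ _ _)
  rw [← hsum (.inr x)]
  simp only [Fintype.sum_sum_type, hsub, hsub', Finset.sum_add_distrib, normalPart]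
  simp

end Counting

/-! ### Structure of a Lie algebra with an invariant inner product. -/

section Reductive

open Module

variable {L : Type*} [LieRing L] [LieAlgebra ℝ L] {q : LinearMap.BilinForm ℝ L}

lemma IsSimple.eq_top_of_lie_mem (h : LieAlgebra.IsSimple ℝ L) (S : LieIdeal ℝ L)
    (hS : ∀ x y : L, ⁅x, y⁆ ∈ S) : S = ⊤ := by
  refine (h.eq_bot_or_eq_top S).resolve_left fun h0 ↦ h.non_abelian ⟨fun x y ↦ ?_⟩
  have := hS x y
  rw [h0] at this
  simpa using this

/-- Distinct simple ideals commute. -/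
lemma lie_eq_zero_of_isSimple {J J' : LieIdeal ℝ L} (hJ : LieAlgebra.IsSimple ℝ J)
    (hJ' : LieAlgebra.IsSimple ℝ J') (hne : J ≠ J') {x y : L} (hx : x ∈ J) (hy : y ∈ J') :
    ⁅x, y⁆ = 0 := by
  have key : ∀ {A B : LieIdeal ℝ L}, LieAlgebra.IsSimple ℝ A →
      (∀ z ∈ A, z ∈ B → z = 0) ∨ A ≤ B := fun {A B} hA ↦ by
    rcases hA.eq_bot_or_eq_top (B.comap A.incl) with h | h
    · left
      intro z hz hzB
      have : (⟨z, hz⟩ : A) ∈ B.comap A.incl := by simpa [LieIdeal.mem_comap] using hzB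
      rw [h] at this
      simpa using this
    · right
      intro z hz
      have : (⟨z, hz⟩ : A) ∈ B.comap A.incl := by rw [h]; trivial
      simpa [LieIdeal.mem_comap] using this
  have hxyJ : ⁅x, y⁆ ∈ J := lie_mem_left ℝ L J x y hx
  have hxyJ' : ⁅x, y⁆ ∈ J' := lie_mem_right ℝ L J' x y hy
  rcases key (B := J') hJ with h | h
  · exact h _ hxyJ hxyJ'
  · rcases key (B := J) hJ' with h' | h'
    · exact h' _ hxyJ' hxyJ
    · exact absurd (le_antisymm h h') hne

/-- A simple ideal is orthogonal to everything that commutes with it. -/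
lemma orthogonal_of_lie_eq_zero (hq : ∀ x y z, q ⁅x, y⁆ z = q x ⁅y, z⁆) {J : LieIdeal ℝ L}
    (hJ : LieAlgebra.IsSimple ℝ J) {y : L} (hy : ∀ x ∈ J, ⁅x, y⁆ = 0) {x : L} (hx : x ∈ J) :
    q x y = 0 := by
  let S : LieIdeal ℝ J :=
    { carrier := {x | q (x : L) y = 0}
      add_mem' := fun {a b} ha hb ↦ by
        simp only [Set.mem_ofPred_eq] at ha hb ⊢
        simp [ha, hb]
      zero_mem' := by simp
      smul_mem' := fun c a ha ↦ by
        simp only [Set.mem_ofPred_eq] at ha ⊢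
        simp [ha]
      lie_mem := fun {u v} _ ↦ by
        change q ((⁅u, v⁆ : J) : L) y = 0
        change q ⁅(u : L), (v : L)⁆ y = 0
        rw [hq, hy _ v.2, map_zero] }
  have hS : S = ⊤ := IsSimple.eq_top_of_lie_mem hJ S fun u v ↦ by
    change q ((⁅u, v⁆ : J) : L) y = 0
    change q ⁅(u : L), (v : L)⁆ y = 0
    rw [hq, hy _ v.2, map_zero]
  have : (⟨x, hx⟩ : J) ∈ S := by rw [hS]; trivial
  exact this

/-- A minimal ideal of a Lie algebra with an invariant inner product is central or simple. -/
lemma IsInnerProduct.isSimple_of_isAtom [FiniteDimensional ℝ L] (hi : IsInnerProduct q)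
    (hq : ∀ x y z, q ⁅x, y⁆ z = q x ⁅y, z⁆) {J : LieIdeal ℝ L} (hJ : IsAtom J) :
    LieAlgebra.IsSimple ℝ J ∨ J ≤ LieAlgebra.center ℝ L := by
  have hlie : ∀ {x y : L}, y ∈ J → (∀ w ∈ J, q x w = 0) → ⁅x, y⁆ = 0 := fun {x y} hy hx ↦ by
    refine hi.eq_zero ?_
    rw [hq]
    exact hx _ (lie_mem_left ℝ L J _ _ hy)
  by_cases hab : IsLieAbelian J
  · right
    intro x hx
    rw [LieModule.mem_maxTrivSubmodule]
    intro y
    refine hi.eq_zero ?_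
    have hyx : ⁅y, x⁆ ∈ J := lie_mem_right ℝ L J _ _ hx
    -- Both entries lie in the abelian ideal `J`; by invariance, `q ⁅y, x⁆ ⁅y, x⁆ = q y ⁅x, ⁅y,
    -- x⁆⁆`.
    have h1 : ⁅x, ⁅y, x⁆⁆ = 0 := by
      have := hab.trivial ⟨x, hx⟩ ⟨_, hyx⟩
      exact congrArg Subtype.val this
    rw [hq, h1, map_zero]
  · left
    refine { eq_bot_or_eq_top := fun S ↦ ?_, non_abelian := hab }
    -- An ideal of `J` is an ideal of `L`: the part of `x` orthogonal to `J` commutes with `J`.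
    -- Minimality of `J` then applies to `S'`.
    let S' : LieIdeal ℝ L :=
      { S.toSubmodule.map J.toSubmodule.subtype with
        lie_mem := by
          rintro x _ ⟨u, hu, rfl⟩
          obtain ⟨w, hw, hxw⟩ := hi.exists_proj J.toSubmodule x
          have h0 : ⁅x - w, (u : L)⁆ = 0 := hlie u.2 hxw
          refine ⟨⁅(⟨w, hw⟩ : J), u⁆, S.lie_mem hu, ?_⟩
          rw [sub_lie, sub_eq_zero] at h0
          exact h0.symm }
    have hmem : ∀ u : J, u ∈ S ↔ (u : L) ∈ S' := fun u ↦ by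
      refine ⟨fun h ↦ ⟨u, h, rfl⟩, ?_⟩
      rintro ⟨u', hu', h⟩
      rwa [← Subtype.ext h]
    have hle : S' ≤ J := by
      rintro _ ⟨u, -, rfl⟩
      exact u.2
    rcases hJ.le_iff.1 hle with h | h
    · left
      rw [LieSubmodule.eq_bot_iff]
      intro u hu
      have := (hmem u).1 hu
      rw [h] at this
      simpa using this
    · right
      rw [eq_top_iff]
      intro u _
      rw [hmem, h]
      exact u.2

/-- A Lie algebra with an invariant inner product is spanned by its centre and its simple
ideals. -/
theorem IsInnerProduct.eq_zero_of_orthogonal_simple [FiniteDimensional ℝ L] (hi : IsInnerProduct q)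
    (hq : ∀ x y z, q ⁅x, y⁆ z = q x ⁅y, z⁆) {x : L}
    (hc : ∀ y ∈ LieAlgebra.center ℝ L, q x y = 0)
    (hs : ∀ J : LieIdeal ℝ L, LieAlgebra.IsSimple ℝ J → ∀ y ∈ J, q x y = 0) : x = 0 := by
  let S : LieIdeal ℝ L :=
    { carrier := {x | (∀ y ∈ LieAlgebra.center ℝ L, q x y = 0) ∧
        ∀ J : LieIdeal ℝ L, LieAlgebra.IsSimple ℝ J → ∀ y ∈ J, q x y = 0}
      add_mem' := fun {a b} ha hb ↦
        ⟨fun y hy ↦ by simp [ha.1 y hy, hb.1 y hy], fun J hJ y hy ↦ by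
          simp [ha.2 J hJ y hy, hb.2 J hJ y hy]⟩
      zero_mem' := by simp
      smul_mem' := fun c a ha ↦
        ⟨fun y hy ↦ by simp [ha.1 y hy], fun J hJ y hy ↦ by simp [ha.2 J hJ y hy]⟩
      lie_mem := fun {u v} hv ↦ by
        refine ⟨fun y hy ↦ ?_, fun J hJ y hy ↦ ?_⟩
        · rw [← lie_skew, map_neg, LinearMap.neg_apply, hq,
            hv.1 _ (lie_mem_right ℝ L _ _ _ hy), neg_zero]
        · rw [← lie_skew, map_neg, LinearMap.neg_apply, hq,
            hv.2 J hJ _ (lie_mem_right ℝ L _ _ _ hy), neg_zero] }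
  -- A minimal ideal inside the orthogonal ideal `S` would be central or simple, hence orthogonal to
  -- itself.
  have hS : S = ⊥ := by
    by_contra hne
    obtain ⟨J, hJ, hJS⟩ := (eq_bot_or_exists_atom_le S).resolve_left hne
    refine hJ.1 ((LieSubmodule.eq_bot_iff J).2 fun y hy ↦ hi.eq_zero ?_)
    rcases hi.isSimple_of_isAtom hq hJ with h | h
    · exact (hJS hy).2 J h y hy
    · exact (hJS hy).1 y (h hy)
  have : x ∈ S := ⟨hc, hs⟩
  rw [hS] at this
  simpa using this

/-- On a simple Lie algebra, every invariant symmetric form is a multiple of an invariant inner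
product. -/
theorem IsInnerProduct.exists_eq_mul_of_isSimple [FiniteDimensional ℝ L] (hi : IsInnerProduct q)
    (hq : ∀ x y z, q ⁅x, y⁆ z = q x ⁅y, z⁆) (hL : LieAlgebra.IsSimple ℝ L)
    {B : LinearMap.BilinForm ℝ L} (hBs : ∀ x y, B x y = B y x)
    (hB : ∀ x y z, B ⁅x, y⁆ z = B x ⁅y, z⁆) : ∃ c : ℝ, ∀ x y, B x y = c * q x y := by
  obtain ⟨b, p, hb, hp⟩ := hi.exists_basis hBs
  rcases Nat.eq_zero_or_pos (finrank ℝ L) with h0 | h0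
  · have : Subsingleton L := finrank_zero_iff.1 h0
    exact absurd ⟨fun x y ↦ Subsingleton.elim _ _⟩ hL.non_abelian
  let i : Fin (finrank ℝ L) := ⟨0, h0⟩
  -- The eigenspace of `B` relative to `q` for the eigenvalue `p i` is a nonzero ideal, hence
  -- everything.
  let S : LieIdeal ℝ L :=
    { carrier := {x | ∀ y, B x y = p i * q x y}
      add_mem' := fun {a c} ha hc y ↦ by simp [ha y, hc y, mul_add]
      zero_mem' := by simp
      smul_mem' := fun c a ha y ↦ by simp [ha y, mul_left_comm]
      lie_mem := fun {u v} hv y ↦ by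
        rw [← lie_skew, map_neg, map_neg, LinearMap.neg_apply, LinearMap.neg_apply, hB, hq, hv]
        ring }
  have hbi : b i ∈ S := fun y ↦ by
    rw [apply_eq_sum_of_orthonormal hb B]
    simp only [hp, mul_ite, mul_zero, Finset.sum_ite_eq, Finset.mem_univ, if_true]
    rw [mul_comm]
  have hS : S = ⊤ := by
    refine (hL.eq_bot_or_eq_top S).resolve_left fun h ↦ b.ne_zero i ?_
    rw [h] at hbi
    simpa using hbi
  exact ⟨p i, fun x ↦ (by rw [hS]; trivial : x ∈ S)⟩

end Reductive

/-! ### Bilinear forms that are diagonal by blocks. -/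

section Blocks

open Module

variable {V A Z : Type*} [AddCommGroup V] [Module ℝ V] [AddCommGroup A] [Module ℝ A]
  [AddCommGroup Z] [Module ℝ Z] {r : ℕ} {X : Fin r → Type*} [∀ i, AddCommGroup (X i)]
  [∀ i, Module ℝ (X i)]

/-- `B = α Q|_A + h + ∑ αᵢ Q|_{Xᵢ}` in terms of maps `A → V`, `Z → V` and `Xᵢ → V`. -/
def IsBlockForm (fA : A →ₗ[ℝ] V) (fZ : Z →ₗ[ℝ] V) (fX : ∀ i, X i →ₗ[ℝ] V)
    (Q B : LinearMap.BilinForm ℝ V) (α : ℝ) (h : LinearMap.BilinForm ℝ Z) (αs : Fin r → ℝ) :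
    Prop :=
  ∀ (a a' : A) (z z' : Z) (x x' : ∀ i, X i),
    B (fA a + fZ z + ∑ i, fX i (x i)) (fA a' + fZ z' + ∑ i, fX i (x' i)) =
      α * Q (fA a) (fA a') + h z z' + ∑ i, αs i * Q (fX i (x i)) (fX i (x' i))

/-- The union of families of vectors of the blocks. -/
def blockFamily {ιA ιZ : Type*} {ιX : Fin r → Type*} (fA : A →ₗ[ℝ] V) (fZ : Z →ₗ[ℝ] V)
    (fX : ∀ i, X i →ₗ[ℝ] V) (bA : ιA → A) (bZ : ιZ → Z) (bX : ∀ i, ιX i → X i) :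
    ιA ⊕ (ιZ ⊕ Σ i, ιX i) → V :=
  Sum.elim (fun a ↦ fA (bA a)) (Sum.elim (fun z ↦ fZ (bZ z)) fun x ↦ fX x.1 (bX x.1 x.2))

lemma IsBlockForm.apply_blockFamily {ιA ιZ : Type*} {ιX : Fin r → Type*} [DecidableEq ιA]
    [DecidableEq ιZ] [∀ i, DecidableEq (ιX i)] {fA : A →ₗ[ℝ] V} {fZ : Z →ₗ[ℝ] V}
    {fX : ∀ i, X i →ₗ[ℝ] V} {Q B : LinearMap.BilinForm ℝ V} {α : ℝ}
    {h : LinearMap.BilinForm ℝ Z} {αs : Fin r → ℝ} (hB : IsBlockForm fA fZ fX Q B α h αs)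
    {bA : ιA → A} {bZ : ιZ → Z} {bX : ∀ i, ιX i → X i} {pz : ιZ → ℝ}
    (hA : ∀ i j, Q (fA (bA i)) (fA (bA j)) = if i = j then 1 else 0)
    (hZ : ∀ i j, h (bZ i) (bZ j) = if i = j then pz i else 0)
    (hX : ∀ l i j, Q (fX l (bX l i)) (fX l (bX l j)) = if i = j then 1 else 0)
    (i j : ιA ⊕ (ιZ ⊕ Σ i, ιX i)) :
    B (blockFamily fA fZ fX bA bZ bX i) (blockFamily fA fZ fX bA bZ bX j) =
      if i = j then Sum.elim (fun _ ↦ α) (Sum.elim pz fun x ↦ αs x.1) i else 0 := by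
  let cA : ιA ⊕ (ιZ ⊕ Σ i, ιX i) → A := Sum.elim bA fun _ ↦ 0
  let cZ : ιA ⊕ (ιZ ⊕ Σ i, ιX i) → Z := Sum.elim (fun _ ↦ 0) (Sum.elim bZ fun _ ↦ 0)
  let cX : ιA ⊕ (ιZ ⊕ Σ i, ιX i) → ∀ i, X i := Sum.elim (fun _ ↦ 0)
    (Sum.elim (fun _ ↦ 0) fun x ↦ Pi.single x.1 (bX x.1 x.2))
  have hsingle : ∀ (l : Fin r) (y : X l), ∑ i, fX i (Pi.single l y i) = fX l y := fun l y ↦ by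
    rw [Fintype.sum_eq_single l fun m hm ↦ by rw [Pi.single_eq_of_ne hm, map_zero],
      Pi.single_eq_same]
  have hc : ∀ i, blockFamily fA fZ fX bA bZ bX i =
      fA (cA i) + fZ (cZ i) + ∑ l, fX l (cX i l) := by
    rintro (a | z | ⟨l, x⟩) <;> simp [blockFamily, cA, cZ, cX, hsingle]
  rw [hc i, hc j, hB]
  rcases i with a | z | ⟨l, x⟩ <;> rcases j with a' | z' | ⟨l', x'⟩
  · simp [cA, cZ, cX, hA]
  · simp [cA, cZ, cX]
  · simp [cA, cZ, cX]
  · simp [cA, cZ, cX]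
  · simp [cA, cZ, cX, hZ]
  · simp [cA, cZ, cX]
  · simp [cA, cZ, cX]
  · simp [cA, cZ, cX]
  · simp only [cA, cZ, cX, Sum.elim_inr, map_zero, mul_zero, zero_add]
    rw [Fintype.sum_eq_single l fun m hm ↦ by rw [Pi.single_eq_of_ne hm]; simp]
    rw [Pi.single_eq_same]
    by_cases hl : l = l'
    · subst hl
      rw [Pi.single_eq_same, hX]
      simp
    · rw [Pi.single_eq_of_ne hl]
      simp [hl]

end Blocks

/-! ### The Killing form as a sum of squared structure constants. -/

section KillingSum

open Module

lemma neg_killingForm_self {L : Type*} [LieRing L] [LieAlgebra ℝ L] {ι : Type*} [Fintype ι]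
    [DecidableEq ι] {q : LinearMap.BilinForm ℝ L} (hs : ∀ x y, q x y = q y x)
    (hq : ∀ x y z, q ⁅x, y⁆ z = q x ⁅y, z⁆) {b : Basis ι ℝ L}
    (hb : ∀ i j, q (b i) (b j) = if i = j then 1 else 0) (x : L) :
    -killingForm ℝ L x x = ∑ j, ∑ k, q ⁅x, b j⁆ (b k) ^ 2 := by
  rw [killingForm_apply_apply, trace_eq_sum_of_orthonormal hb, ← Finset.sum_neg_distrib]
  refine Finset.sum_congr rfl fun j _ ↦ ?_
  simp only [LinearMap.comp_apply, LieAlgebra.ad_apply]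
  rw [← hq, ← lie_skew, map_neg, LinearMap.neg_apply, neg_neg, apply_eq_sum_of_orthonormal hb]
  refine Finset.sum_congr rfl fun k _ ↦ ?_
  rw [hs, sq]

end KillingSum

/-! ### The splitting defined by a subalgebra. -/

section Isotropy

open Module

variable {L : Type*} [LieRing L] [LieAlgebra ℝ L] {𝔨 : LieSubalgebra ℝ L}
  {Q : LinearMap.BilinForm ℝ L}

/-- The inclusion of an ideal of a subalgebra. -/
def idealMap (J : LieIdeal ℝ 𝔨) : J →ₗ[ℝ] L where
  toFun x := ((x : 𝔨) : L)
  map_add' _ _ := rfl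
  map_smul' _ _ := rfl

lemma idealMap_injective (J : LieIdeal ℝ 𝔨) : Function.Injective (idealMap J) := fun _ _ h ↦
  Subtype.ext (Subtype.ext h)

lemma idealMap_mem (J : LieIdeal ℝ 𝔨) (x : J) : idealMap J x ∈ 𝔨 := (x : 𝔨).2

lemma lie_idealMap_eq_zero_of_isSimple {J J' : LieIdeal ℝ 𝔨} (hJ : LieAlgebra.IsSimple ℝ J)
    (hJ' : LieAlgebra.IsSimple ℝ J') (hne : J ≠ J') (x : J) (y : J') :
    ⁅idealMap J x, idealMap J' y⁆ = 0 :=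
  congrArg Subtype.val (lie_eq_zero_of_isSimple hJ hJ' hne x.2 y.2)

lemma lie_idealMap_center (x : 𝔨) (z : LieAlgebra.center ℝ 𝔨) :
    ⁅(x : L), idealMap (LieAlgebra.center ℝ 𝔨) z⁆ = 0 :=
  congrArg Subtype.val ((LieModule.mem_maxTrivSubmodule (R := ℝ) (L := 𝔨) (M := 𝔨) z.1).1 z.2 x)

lemma lie_center_idealMap (x : 𝔨) (z : LieAlgebra.center ℝ 𝔨) :
    ⁅idealMap (LieAlgebra.center ℝ 𝔨) z, (x : L)⁆ = 0 := by
  rw [← lie_skew, lie_idealMap_center, neg_zero]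

lemma orthogonal_idealMap_of_lie_eq_zero (hQi : ∀ x y z, Q ⁅x, y⁆ z = Q x ⁅y, z⁆)
    {J : LieIdeal ℝ 𝔨} (hJ : LieAlgebra.IsSimple ℝ J) {y : 𝔨}
    (hy : ∀ x : J, ⁅idealMap J x, (y : L)⁆ = 0) (x : J) : Q (idealMap J x) (y : L) = 0 :=
  orthogonal_of_lie_eq_zero (L := 𝔨) (q := Q.compl₁₂ 𝔨.toSubmodule.subtype 𝔨.toSubmodule.subtype)
    (fun a b c ↦ hQi a b c) hJ (fun a ha ↦ Subtype.ext (hy ⟨a, ha⟩)) x.2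

variable {r : ℕ} {k : Fin r → LieIdeal ℝ 𝔨}

/-- Orthogonality of the splitting: inside `𝔨`, a simple ideal is orthogonal to whatever commutes
with it, namely the centre and the other simple ideals. -/
lemma isBlockForm_self (hQs : ∀ x y, Q x y = Q y x) (hQi : ∀ x y z, Q ⁅x, y⁆ z = Q x ⁅y, z⁆)
    (hk : ∀ i, LieAlgebra.IsSimple ℝ (k i)) (hinj : Function.Injective k) :
    IsBlockForm (Q.orthogonal 𝔨.toSubmodule).subtype (idealMap (LieAlgebra.center ℝ 𝔨))
      (fun i ↦ idealMap (k i)) Q Q 1 (Q.compl₁₂ (idealMap (LieAlgebra.center ℝ 𝔨))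
        (idealMap (LieAlgebra.center ℝ 𝔨))) (fun _ ↦ 1) := by
  intro a a' z z' x x'
  have hka : ∀ (y : L) (a : Q.orthogonal 𝔨.toSubmodule), y ∈ 𝔨 → Q y a = 0 := fun y a hy ↦
    a.2 y hy
  have hak : ∀ (y : L) (a : Q.orthogonal 𝔨.toSubmodule), y ∈ 𝔨 → Q a y = 0 := fun y a hy ↦
    (hQs _ _).trans (hka y a hy)
  have hxz : ∀ i x z, Q (idealMap (k i) x) (idealMap (LieAlgebra.center ℝ 𝔨) z) = 0 :=
    fun i x z ↦ orthogonal_idealMap_of_lie_eq_zero hQi (hk i) (y := z.1)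
      (fun x ↦ lie_idealMap_center x.1 z) x
  have hxx : ∀ i j, i ≠ j → ∀ x y, Q (idealMap (k i) x) (idealMap (k j) y) = 0 :=
    fun i j hij x y ↦ orthogonal_idealMap_of_lie_eq_zero hQi (hk i) (y := y.1)
      (fun x ↦ lie_idealMap_eq_zero_of_isSimple (hk i) (hk j) (hinj.ne hij) x y) x
  have hsum : ∀ i, ∑ j, Q (idealMap (k i) (x i)) (idealMap (k j) (x' j)) =
      Q (idealMap (k i) (x i)) (idealMap (k i) (x' i)) := fun i ↦
    Fintype.sum_eq_single i fun j hj ↦ hxx i j hj.symm _ _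
  simp only [map_add, LinearMap.add_apply, map_sum, LinearMap.sum_apply, Submodule.subtype_apply,
    hak _ _ (idealMap_mem _ _), hka _ _ (idealMap_mem _ _), hxz, hQs (idealMap _ z),
    Finset.sum_const_zero, LinearMap.compl₁₂_apply, one_mul, add_zero, zero_add]
  rw [Finset.sum_comm]
  simp only [hsum]

/-- Completeness of the splitting. The projection of `x` to `𝔨` vanishes because the centre and the
simple ideals span `𝔨`; then `x` lies in the complement and is orthogonal to itself. -/
lemma eq_zero_of_orthogonal_blocks [FiniteDimensional ℝ L] (hQ : IsInnerProduct Q)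
    (hQi : ∀ x y z, Q ⁅x, y⁆ z = Q x ⁅y, z⁆)
    (hsurj : ∀ J : LieIdeal ℝ 𝔨, LieAlgebra.IsSimple ℝ J → ∃ i, k i = J) {x : L}
    (hA : ∀ a ∈ Q.orthogonal 𝔨.toSubmodule, Q x a = 0)
    (hZ : ∀ z, Q x (idealMap (LieAlgebra.center ℝ 𝔨) z) = 0)
    (hX : ∀ i y, Q x (idealMap (k i) y) = 0) : x = 0 := by
  obtain ⟨w, hw, hwx⟩ := hQ.exists_proj 𝔨.toSubmodule x
  have hwQ : ∀ y ∈ 𝔨, Q w y = Q x y := fun y hy ↦ by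
    have := hwx y hy
    rw [map_sub, LinearMap.sub_apply] at this
    linarith
  have hw0 : (⟨w, hw⟩ : 𝔨) = 0 :=
    (hQ.restrict 𝔨.toSubmodule.subtype
      𝔨.toSubmodule.injective_subtype).eq_zero_of_orthogonal_simple (L := 𝔨)
      (fun a b c ↦ hQi a b c) (fun y hy ↦ (hwQ y y.2).trans (hZ ⟨y, hy⟩)) fun J hJ y hy ↦ by
        obtain ⟨i, rfl⟩ := hsurj J hJ
        exact (hwQ y y.2).trans (hX i ⟨y, hy⟩)
  have hw0' : w = 0 := congrArg Subtype.val hw0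
  subst hw0'
  refine hQ.eq_zero (hA x fun y hy ↦ ?_)
  change Q y x = 0
  rw [hQ.symm, ← hwQ y hy, map_zero, LinearMap.zero_apply]

/-- A simple ideal of a subalgebra of a simple Lie algebra does not commute with the orthogonal
complement of the subalgebra unless this complement vanishes. -/
lemma orthogonal_eq_bot_of_lie_eq_zero [FiniteDimensional ℝ L] (hL : LieAlgebra.IsSimple ℝ L)
    (hQ : IsInnerProduct Q) {J : LieIdeal ℝ 𝔨} (hJ : LieAlgebra.IsSimple ℝ J)
    (h : ∀ (x : J), ∀ a ∈ Q.orthogonal 𝔨.toSubmodule, ⁅idealMap J x, a⁆ = 0) :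
    Q.orthogonal 𝔨.toSubmodule = ⊥ := by
  -- Only the `𝔨`-component of an element of `L` acts on `J`, so `J` is an ideal of `L`, which is
  -- then zero or everything.
  let S : LieIdeal ℝ L :=
    { LinearMap.range (idealMap J) with
      lie_mem := fun {x m} hm ↦ by
        obtain ⟨y, rfl⟩ := hm
        obtain ⟨w, hw, hwx⟩ := hQ.exists_proj 𝔨.toSubmodule x
        have h1 : ⁅idealMap J y, x - w⁆ = 0 := h y _ fun z hz ↦
          (hQ.symm _ _).trans (hwx z hz)
        have h2 : ⁅x, idealMap J y⁆ = ⁅w, idealMap J y⁆ := by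
          rw [← sub_eq_zero, ← sub_lie, ← lie_skew, h1, neg_zero]
        rw [h2]
        exact ⟨⟨⁅(⟨w, hw⟩ : 𝔨), (y : 𝔨)⁆, lie_mem_right ℝ 𝔨 J _ _ y.2⟩, rfl⟩ }
  have hS : ∀ y, idealMap J y ∈ S := fun y ↦ ⟨y, rfl⟩
  rcases hL.eq_bot_or_eq_top S with h0 | h1
  · refine absurd ⟨fun x y ↦ ?_⟩ hJ.non_abelian
    refine idealMap_injective J ?_
    have := hS ⁅x, y⁆
    rw [h0] at this
    simpa using this
  · rw [eq_bot_iff]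
    intro a ha
    have ha' : a ∈ S := by rw [h1]; trivial
    obtain ⟨y, rfl⟩ := ha'
    exact hQ.eq_zero (ha _ (idealMap_mem J y))

end Isotropy

/-! ### Structure constants in an adapted basis. -/

section Constants

open Module

variable {L : Type*} [LieRing L] [LieAlgebra ℝ L] {𝔨 : LieSubalgebra ℝ L}
  {Q : LinearMap.BilinForm ℝ L} {r : ℕ} {k : Fin r → LieIdeal ℝ 𝔨} {κ : Fin r → ℝ}
  {ιA ιZ : Type*} {ιX : Fin r → Type*}

/-- A family of vectors adapted to the splitting given by a subalgebra `𝔨` into its orthogonal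
complement, its centre and its simple ideals. -/
def adaptedFamily (bA : ιA → Q.orthogonal 𝔨.toSubmodule) (bZ : ιZ → LieAlgebra.center ℝ 𝔨)
    (bX : ∀ l, ιX l → k l) : ιA ⊕ (ιZ ⊕ Σ l, ιX l) → L :=
  blockFamily (Q.orthogonal 𝔨.toSubmodule).subtype (idealMap (LieAlgebra.center ℝ 𝔨))
    (fun l ↦ idealMap (k l)) bA bZ bX

/-- The squared structure constants in an adapted family of vectors. -/
def adaptedConstant (bA : ιA → Q.orthogonal 𝔨.toSubmodule) (bZ : ιZ → LieAlgebra.center ℝ 𝔨)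
    (bX : ∀ l, ιX l → k l) (i j m : ιA ⊕ (ιZ ⊕ Σ l, ιX l)) : ℝ :=
  structureConstant Q (adaptedFamily bA bZ bX) i j m ^ 2

variable {bA : ιA → Q.orthogonal 𝔨.toSubmodule} {bZ : ιZ → LieAlgebra.center ℝ 𝔨}
  {bX : ∀ l, ιX l → k l}

lemma adaptedFamily_inr_mem (y : ιZ ⊕ Σ l, ιX l) : adaptedFamily bA bZ bX (.inr y) ∈ 𝔨 := by
  rcases y with z | x
  · exact idealMap_mem _ _
  · exact idealMap_mem _ _

lemma adaptedConstant_swap (i j m) :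
    adaptedConstant bA bZ bX j i m = adaptedConstant bA bZ bX i j m := by
  simp only [adaptedConstant]
  rw [structureConstant_swap, neg_sq]

lemma adaptedConstant_cycle (hQs : ∀ x y, Q x y = Q y x)
    (hQi : ∀ x y z, Q ⁅x, y⁆ z = Q x ⁅y, z⁆) (i j m) :
    adaptedConstant bA bZ bX j m i = adaptedConstant bA bZ bX i j m := by
  simp only [adaptedConstant]
  rw [structureConstant_cycle hQs hQi]

lemma adaptedConstant_eq_zero_of_lie {i j : ιA ⊕ (ιZ ⊕ Σ l, ιX l)}
    (h : ⁅adaptedFamily bA bZ bX i, adaptedFamily bA bZ bX j⁆ = 0) (m) :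
    adaptedConstant bA bZ bX i j m = 0 := by
  simp [adaptedConstant, structureConstant, h]

lemma adaptedConstant_isotropy_normal (x y a) :
    adaptedConstant bA bZ bX (.inr x) (.inr y) (.inl a) = 0 := by
  have : Q ⁅adaptedFamily bA bZ bX (.inr x), adaptedFamily bA bZ bX (.inr y)⁆ (bA a : L) = 0 :=
    (bA a).2 _ (𝔨.lie_mem (adaptedFamily_inr_mem x) (adaptedFamily_inr_mem y))
  exact (sq_eq_zero_iff).2 this

lemma adaptedConstant_center (z y m) :
    adaptedConstant bA bZ bX (.inr (.inl z)) (.inr y) m = 0 :=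
  adaptedConstant_eq_zero_of_lie
    (lie_center_idealMap ⟨_, adaptedFamily_inr_mem (bA := bA) y⟩ (bZ z)) m

lemma exists_eq_of_adaptedConstant_ne_zero (hk : ∀ i, LieAlgebra.IsSimple ℝ (k i))
    (hinj : Function.Injective k) {x : Σ l, ιX l} {y m}
    (h : adaptedConstant bA bZ bX (.inr (.inr x)) (.inr y) m ≠ 0) :
    ∃ j, y = .inr ⟨x.1, j⟩ := by
  rcases y with z | ⟨l, j⟩
  · exact absurd (adaptedConstant_eq_zero_of_lie (lie_idealMap_center (bX x.1 x.2).1 (bZ z)) m) h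
  · by_cases hl : l = x.1
    · subst hl
      exact ⟨j, rfl⟩
    · exact absurd (adaptedConstant_eq_zero_of_lie (lie_idealMap_eq_zero_of_isSimple (hk _) (hk _)
        (hinj.ne (Ne.symm hl)) (bX x.1 x.2) (bX l j)) m) h

lemma exists_eq_of_adaptedConstant_ne_zero' (hQs : ∀ x y, Q x y = Q y x)
    (hQi : ∀ x y z, Q ⁅x, y⁆ z = Q x ⁅y, z⁆) (hk : ∀ i, LieAlgebra.IsSimple ℝ (k i))
    (hinj : Function.Injective k) {x : Σ l, ιX l} {m y}
    (h : adaptedConstant bA bZ bX (.inr (.inr x)) m (.inr y) ≠ 0) :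
    ∃ j, y = .inr ⟨x.1, j⟩ := by
  rw [← adaptedConstant_cycle hQs hQi, ← adaptedConstant_cycle hQs hQi,
    adaptedConstant_swap] at h
  exact exists_eq_of_adaptedConstant_ne_zero hk hinj h

/-- Only indices in the same simple ideal contribute, so the sum is minus the Killing form of that
ideal on a `Q`-unit vector. -/
lemma sum_adaptedConstant_ideal [Fintype ιZ] [∀ l, Fintype (ιX l)] [∀ l, DecidableEq (ιX l)]
    (hQs : ∀ x y, Q x y = Q y x)
    (hQi : ∀ x y z, Q ⁅x, y⁆ z = Q x ⁅y, z⁆) (hk : ∀ i, LieAlgebra.IsSimple ℝ (k i))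
    (hinj : Function.Injective k) {bX : ∀ l, Basis (ιX l) ℝ (k l)}
    (hX : ∀ l i j, Q (idealMap (k l) (bX l i)) (idealMap (k l) (bX l j)) = if i = j then 1 else 0)
    (hκ : ∀ i x y, killingForm ℝ (k i) x y = -κ i * Q (idealMap (k i) x) (idealMap (k i) y))
    (x : Σ l, ιX l) :
    ∑ y, ∑ y', adaptedConstant bA bZ (fun l ↦ bX l) (.inr (.inr x)) (.inr y) (.inr y') =
      κ x.1 := by
  obtain ⟨l, i⟩ := x
  have h0 : ∀ y y', (∀ j, y ≠ .inr ⟨l, j⟩) →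
      adaptedConstant bA bZ (fun l ↦ bX l) (.inr (.inr ⟨l, i⟩)) (.inr y) (.inr y') = 0 :=
    fun y y' hy ↦ by
      by_contra h
      obtain ⟨j, hj⟩ := exists_eq_of_adaptedConstant_ne_zero hk hinj h
      exact hy j hj
  have h0' : ∀ y y', (∀ j, y' ≠ .inr ⟨l, j⟩) →
      adaptedConstant bA bZ (fun l ↦ bX l) (.inr (.inr ⟨l, i⟩)) (.inr y) (.inr y') = 0 :=
    fun y y' hy ↦ by
      by_contra h
      obtain ⟨j, hj⟩ := exists_eq_of_adaptedConstant_ne_zero' hQs hQi hk hinj h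
      exact hy j hj
  have hsum : ∀ f : (ιZ ⊕ Σ l, ιX l) → ℝ, (∀ y, (∀ j, y ≠ .inr ⟨l, j⟩) → f y = 0) →
      ∑ y, f y = ∑ j, f (.inr ⟨l, j⟩) := fun f hf ↦ by
    rw [Fintype.sum_sum_type, Finset.sum_eq_zero fun z _ ↦ hf _ fun j ↦ by simp, zero_add,
      Fintype.sum_sigma]
    refine Fintype.sum_eq_single l fun l' hl' ↦ Finset.sum_eq_zero fun j' _ ↦ hf _ fun j hj ↦ ?_
    exact hl' (congrArg Sigma.fst (Sum.inr_injective hj))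
  rw [hsum _ fun y hy ↦ Finset.sum_eq_zero fun y' _ ↦ h0 y y' hy,
    Finset.sum_congr rfl fun j _ ↦ hsum _ (h0' _)]
  have h1 := neg_killingForm_self (q := Q.compl₁₂ (idealMap (k l)) (idealMap (k l)))
    (fun a b ↦ hQs _ _) (fun a b c ↦ hQi _ _ _) (hX l) (bX l i)
  rw [hκ, hX, if_pos rfl] at h1
  refine Eq.trans ?_ (h1.symm.trans (by simp))
  rfl

end Constants

/-! ### The inequality for a subalgebra of a simple Lie algebra. -/

section Inequality

open Module

variable {L : Type*} [LieRing L] [LieAlgebra ℝ L] [FiniteDimensional ℝ L] {𝔨 : LieSubalgebra ℝ L}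
  {Q : LinearMap.BilinForm ℝ L} {r : ℕ} {k : Fin r → LieIdeal ℝ 𝔨} {κ : Fin r → ℝ}

/-- A block form is diagonal in a suitable orthonormal basis adapted to the splitting. -/
lemma exists_adapted_basis (hQ : IsInnerProduct Q) (hQi : ∀ x y z, Q ⁅x, y⁆ z = Q x ⁅y, z⁆)
    (hk : ∀ i, LieAlgebra.IsSimple ℝ (k i)) (hinj : Function.Injective k)
    (hsurj : ∀ J : LieIdeal ℝ 𝔨, LieAlgebra.IsSimple ℝ J → ∃ i, k i = J)
    {h : LinearMap.BilinForm ℝ (LieAlgebra.center ℝ 𝔨)} (hh : IsInnerProduct h) :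
    ∃ (bA : Basis (Fin (finrank ℝ (Q.orthogonal 𝔨.toSubmodule))) ℝ (Q.orthogonal 𝔨.toSubmodule))
      (bZ : Basis (Fin (finrank ℝ (LieAlgebra.center ℝ 𝔨))) ℝ (LieAlgebra.center ℝ 𝔨))
      (bX : ∀ l, Basis (Fin (finrank ℝ (k l))) ℝ (k l))
      (pz : Fin (finrank ℝ (LieAlgebra.center ℝ 𝔨)) → ℝ)
      (b : Basis (Fin (finrank ℝ (Q.orthogonal 𝔨.toSubmodule)) ⊕
        (Fin (finrank ℝ (LieAlgebra.center ℝ 𝔨)) ⊕ Σ l, Fin (finrank ℝ (k l)))) ℝ L),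
      (∀ z, 0 < pz z) ∧ (∀ i, b i = adaptedFamily bA bZ (fun l ↦ bX l) i) ∧
      (∀ i j, Q (b i) (b j) = if i = j then 1 else 0) ∧
      (∀ i j, Q (bA i : L) (bA j) = if i = j then 1 else 0) ∧
      (∀ i j, h (bZ i) (bZ j) = if i = j then pz i else 0) ∧
      ∀ l i j, Q (idealMap (k l) (bX l i)) (idealMap (k l) (bX l j)) =
        if i = j then 1 else 0 := by
  obtain ⟨bA, -, hA, -⟩ := (hQ.restrict (Q.orthogonal 𝔨.toSubmodule).subtype
    (Submodule.injective_subtype _)).exists_basis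
    (g := Q.compl₁₂ (Q.orthogonal 𝔨.toSubmodule).subtype (Q.orthogonal 𝔨.toSubmodule).subtype)
    fun x y ↦ hQ.symm x y
  obtain ⟨bZ, pz, hZ, hpz⟩ := (hQ.restrict (idealMap (LieAlgebra.center ℝ 𝔨))
    (idealMap_injective _)).exists_basis hh.symm
  have hX : ∀ l, ∃ b : Basis (Fin (finrank ℝ (k l))) ℝ (k l),
      ∀ i j, Q (idealMap (k l) (b i)) (idealMap (k l) (b j)) = if i = j then 1 else 0 := fun l ↦ by
    obtain ⟨b, -, hb, -⟩ := (hQ.restrict (idealMap (k l))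
      (idealMap_injective _)).exists_basis (g := Q.compl₁₂ (idealMap (k l)) (idealMap (k l)))
      fun x y ↦ hQ.symm _ _
    exact ⟨b, hb⟩
  choose bX hX using hX
  have he : ∀ i j, Q (adaptedFamily bA bZ (fun l ↦ bX l) i) (adaptedFamily bA bZ (fun l ↦ bX l) j) =
      if i = j then 1 else 0 := fun i j ↦ by
    refine ((isBlockForm_self hQ.symm hQi hk hinj).apply_blockFamily (pz := fun _ ↦ 1) hA hZ
      hX i j).trans ?_
    rcases i with a | z | x <;> rfl
  obtain ⟨b, hb⟩ := IsInnerProduct.exists_basis_of_orthonormal he fun x hx ↦ by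
    refine eq_zero_of_orthogonal_blocks hQ hQi hsurj (fun a ha ↦ ?_) (fun z ↦ ?_) fun i y ↦ ?_
    · have : (Q x).comp (Q.orthogonal 𝔨.toSubmodule).subtype = 0 :=
        bA.ext fun i ↦ (hQ.symm _ _).trans (hx (.inl i))
      exact LinearMap.congr_fun this ⟨a, ha⟩
    · have : (Q x).comp (idealMap (LieAlgebra.center ℝ 𝔨)) = 0 :=
        bZ.ext fun i ↦ (hQ.symm _ _).trans (hx (.inr (.inl i)))
      exact LinearMap.congr_fun this z
    · have : (Q x).comp (idealMap (k i)) = 0 :=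
        (bX i).ext fun j ↦ (hQ.symm _ _).trans (hx (.inr (.inr ⟨i, j⟩)))
      exact LinearMap.congr_fun this y
  refine ⟨bA, bZ, bX, pz, b, fun z ↦ ?_, hb, fun i j ↦ by rw [hb, hb, he], hA, hpz, hX⟩
  have := hh.pos (bZ z) (bZ.ne_zero z)
  rwa [hpz, if_pos rfl] at this

/-- The algebraic core: an upper bound for `c` from the trace over `𝔞` and a strict lower bound from
each simple ideal. -/
theorem finrank_mul_iSup_lt (hL : LieAlgebra.IsSimple ℝ L)
    (hQL : ∀ x, Q x x = -killingForm ℝ L x x) (hQ : IsInnerProduct Q)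
    (hQi : ∀ x y z, Q ⁅x, y⁆ z = Q x ⁅y, z⁆) (h𝔞 : Q.orthogonal 𝔨.toSubmodule ≠ ⊥)
    (hk : ∀ i, LieAlgebra.IsSimple ℝ (k i)) (hinj : Function.Injective k)
    (hsurj : ∀ J : LieIdeal ℝ 𝔨, LieAlgebra.IsSimple ℝ J → ∃ i, k i = J)
    (hκ : ∀ i x y, killingForm ℝ (k i) x y = -κ i * Q (idealMap (k i) x) (idealMap (k i) y))
    {g T : LinearMap.BilinForm ℝ L} {α Ta : ℝ}
    {h w : LinearMap.BilinForm ℝ (LieAlgebra.center ℝ 𝔨)} {αs Ts : Fin r → ℝ}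
    (hT : IsBlockForm (Q.orthogonal 𝔨.toSubmodule).subtype (idealMap (LieAlgebra.center ℝ 𝔨))
      (fun i ↦ idealMap (k i)) Q T Ta w Ts) (hTa : 0 < Ta) (hTs : ∀ i, 0 < Ts i)
    (hg : IsBlockForm (Q.orthogonal 𝔨.toSubmodule).subtype (idealMap (LieAlgebra.center ℝ 𝔨))
      (fun i ↦ idealMap (k i)) Q g α h αs) (hgi : IsInnerProduct g) (hα : 0 < α)
    (hh : IsInnerProduct h) (hαs : ∀ i, 0 < αs i) {c : ℝ} {Γ : L →ₗ[ℝ] L →ₗ[ℝ] L}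
    (hskew : ∀ X Y Z, g (Γ X Y) Z + g Y (Γ X Z) = 0) (htor : ∀ X Y, Γ X Y - Γ Y X = ⁅X, Y⁆)
    (hRic : ∀ v, ∃ Ric : L →ₗ[ℝ] L, (∀ w, Ric w = Γ w (Γ v v) - Γ v (Γ w v) - Γ ⁅w, v⁆ v) ∧
      c * T v v = LinearMap.trace ℝ L Ric) :
    (finrank ℝ (Q.orthogonal 𝔨.toSubmodule) : ℝ) * Ta * (⨆ i, κ i / Ts i) <
      2 * ∑ j, (finrank ℝ (k j) : ℝ) * (1 - κ j) + 2 * (finrank ℝ (LieAlgebra.center ℝ 𝔨) : ℝ) +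
        (finrank ℝ (Q.orthogonal 𝔨.toSubmodule) : ℝ) := by
  obtain ⟨bA, bZ, bX, pz, b, hpz, hb, hbQ, hA, hZ, hX⟩ :=
    exists_adapted_basis hQ hQi hk hinj hsurj hh
  set p : Fin (finrank ℝ (Q.orthogonal 𝔨.toSubmodule)) ⊕
      (Fin (finrank ℝ (LieAlgebra.center ℝ 𝔨)) ⊕ Σ l, Fin (finrank ℝ (k l))) → ℝ :=
    Sum.elim (fun _ ↦ α) (Sum.elim pz fun x ↦ αs x.1)
  have hbg : ∀ i j, g (b i) (b j) = if i = j then p i else 0 := fun i j ↦ by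
    rw [hb, hb]
    exact hg.apply_blockFamily hA hZ hX i j
  have hp : ∀ i, 0 < p i := by
    rintro (a | z | x)
    exacts [hα, hpz z, hαs x.1]
  set s := adaptedConstant bA bZ (fun l ↦ bX l) with hs_def
  have hric : ∀ i, c * T (b i) (b i) =
      ∑ j, ∑ m, s i j m * (p i ^ 2 - (p j - p m) ^ 2) / (4 * (p j * p m)) := fun i ↦ by
    obtain ⟨Ric, hR, hR'⟩ := hRic (b i)
    rw [hR', trace_ricci_basis hQ.symm hQi hbQ hp hgi.symm hbg hskew htor hR]
    simp only [hs_def, adaptedConstant, structureConstant, hb]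
  have hTA : ∀ a, T (b (.inl a)) (b (.inl a)) = Ta := fun a ↦ by
    have := hT (bA a) (bA a) 0 0 0 0
    simp only [map_zero, Pi.zero_apply, Finset.sum_const_zero, add_zero,
      mul_zero, Submodule.subtype_apply, hA, if_true, mul_one] at this
    rw [hb]
    exact this
  have hTX : ∀ x, T (b (.inr (.inr x))) (b (.inr (.inr x))) = Ts x.1 := fun x ↦ by
    have hsingle : ∑ i, idealMap (k i) (Pi.single (M := fun l ↦ k l) x.1 (bX x.1 x.2) i) =
        idealMap (k x.1) (bX x.1 x.2) := by
      rw [Fintype.sum_eq_single x.1 fun m hm ↦ by rw [Pi.single_eq_of_ne hm, map_zero],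
        Pi.single_eq_same]
    have := hT 0 0 0 0 (Pi.single x.1 (bX x.1 x.2)) (Pi.single x.1 (bX x.1 x.2))
    rw [hsingle, Fintype.sum_eq_single x.1 fun m hm ↦ by rw [Pi.single_eq_of_ne hm]; simp,
      Pi.single_eq_same, hX, if_pos rfl] at this
    simp only [map_zero, zero_add, mul_zero, mul_one] at this
    rw [hb]
    exact this
  have hs : ∀ i j m, 0 ≤ s i j m := fun i j m ↦ sq_nonneg _
  have hcyc : ∀ i j m, s j m i = s i j m := adaptedConstant_cycle hQ.symm hQi
  have hsum : ∀ i, ∑ j, ∑ m, s i j m = 1 := fun i ↦ by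
    have := neg_killingForm_self hQ.symm hQi hbQ (b i)
    rw [← hQL, hbQ, if_pos rfl] at this
    rw [this]
    simp only [hs_def, adaptedConstant, structureConstant, hb]
  have hsub : ∀ x y a, s (.inr x) (.inr y) (.inl a) = 0 := adaptedConstant_isotropy_normal
  have hnZ : ∀ z, normalPart s (.inl z) = 1 := fun z ↦ by
    rw [normalPart_eq hcyc hsum hsub]
    simp only [hs_def, adaptedConstant_center, Finset.sum_const_zero, sub_zero]
  have hsX : ∀ x : Σ l, Fin (finrank ℝ (k l)),
      ∑ y, ∑ y', s (.inr (.inr x)) (.inr y) (.inr y') = κ x.1 :=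
    sum_adaptedConstant_ideal hQ.symm hQi hk hinj hX hκ
  have hnX : ∀ x, normalPart s (.inr x) = 1 - κ x.1 := fun x ↦ by
    rw [normalPart_eq hcyc hsum hsub, hsX]
  have hnsum : ∑ x, normalPart s x = finrank ℝ (LieAlgebra.center ℝ 𝔨) +
      ∑ j, (finrank ℝ (k j) : ℝ) * (1 - κ j) := by
    simp only [Fintype.sum_sum_type, hnZ, hnX, Fintype.sum_sigma]
    simp [mul_sub]
  have hn : 0 < finrank ℝ (Q.orthogonal 𝔨.toSubmodule) := by
    rw [Nat.pos_iff_ne_zero]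
    exact fun h0 ↦ h𝔞 (Submodule.finrank_eq_zero.1 h0)
  have hle : finrank ℝ (Q.orthogonal 𝔨.toSubmodule) * (c * Ta) ≤
      (2 * ∑ x, normalPart s x + finrank ℝ (Q.orthogonal 𝔨.toSubmodule)) / 4 := by
    have := sum_ricci_normal_le hs adaptedConstant_swap hcyc hsum hsub hp
      (q := α) (fun _ ↦ rfl) hα
    simp only [← hric, hTA] at this
    simpa using this
  -- `normalPart` is nonnegative and equals `1 - κ l`. If it vanished, every bracket of `k l` with
  -- `𝔞` would vanish, forcing `𝔞 = 0`.
  have hκlt : ∀ l, κ l < 1 := fun l ↦ by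
    have hd : 0 < finrank ℝ (k l) := by
      rw [Nat.pos_iff_ne_zero]
      intro h0
      have : Subsingleton (k l) := finrank_zero_iff.1 h0
      exact (hk l).non_abelian ⟨fun x y ↦ Subsingleton.elim _ _⟩
    have hnonneg : ∀ x, 0 ≤ normalPart s x := fun x ↦
      Finset.sum_nonneg fun a _ ↦ Finset.sum_nonneg fun a' _ ↦ hs _ _ _
    have h0 := hnonneg (.inr ⟨l, ⟨0, hd⟩⟩)
    rw [hnX] at h0
    refine lt_of_le_of_ne (by simpa using h0) fun h1 ↦ h𝔞 ?_
    refine orthogonal_eq_bot_of_lie_eq_zero hL hQ (hk l) fun x a ha ↦ ?_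
    have hz : ∀ i a, ⁅b (.inr (.inr ⟨l, i⟩)), b (.inl a)⁆ = 0 := fun i a ↦ by
      have h2 : normalPart s (.inr ⟨l, i⟩) = 0 := by rw [hnX, h1, sub_self]
      have h3 : ∀ m, s (.inr (.inr ⟨l, i⟩)) (.inl a) m = 0 := by
        rintro (a' | y)
        · have h4 := (Finset.sum_eq_zero_iff_of_nonneg fun a _ ↦
            Finset.sum_nonneg fun a' _ ↦ hs _ _ _).1 h2 a (Finset.mem_univ _)
          exact (Finset.sum_eq_zero_iff_of_nonneg fun a' _ ↦ hs _ _ _).1 h4 a'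
            (Finset.mem_univ _)
        · rw [hcyc, hsub]
      refine hQ.eq_zero ?_
      rw [apply_eq_sum_of_orthonormal hbQ]
      refine Finset.sum_eq_zero fun m _ ↦ mul_eq_zero_of_right _ ?_
      have := sq_eq_zero_iff.1 (h3 m)
      simpa only [structureConstant, ← hb] using this
    have hB : (LieAlgebra.ad ℝ L : L →ₗ[ℝ] L →ₗ[ℝ] L).compl₁₂ (idealMap (k l))
        (Q.orthogonal 𝔨.toSubmodule).subtype = 0 := by
      refine LinearMap.ext_basis (bX l) bA fun i a ↦ ?_
      have := hz i a
      rw [hb, hb] at this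
      exact this
    exact LinearMap.congr_fun (LinearMap.congr_fun hB x) ⟨a, ha⟩
  have hlt : ∀ l, κ l / Ts l < 4 * c := fun l ↦ by
    have hd : 0 < finrank ℝ (k l) := by
      rw [Nat.pos_iff_ne_zero]
      intro h0
      have : Subsingleton (k l) := finrank_zero_iff.1 h0
      exact (hk l).non_abelian ⟨fun x y ↦ Subsingleton.elim _ _⟩
    -- Any basis vector of `k l` serves; the zeroth exists because a simple ideal is nonzero.
    have h1 := hric (.inr (.inr ⟨l, ⟨0, hd⟩⟩))
    rw [ricci_isotropy_eq hcyc hsub hp (q := α) (fun _ ↦ rfl) (fun y y' hy ↦ by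
      obtain ⟨j, rfl⟩ := exists_eq_of_adaptedConstant_ne_zero hk hinj hy
      obtain ⟨j', rfl⟩ := exists_eq_of_adaptedConstant_ne_zero' hQ.symm hQi hk hinj hy
      exact ⟨rfl, rfl⟩), hTX, hsX, hnX] at h1
    have h2 : 0 < (1 - κ l) * (αs l / α) ^ 2 :=
      mul_pos (sub_pos.2 (hκlt l)) (pow_pos (div_pos (hαs l) hα) 2)
    rw [div_lt_iff₀ (hTs l)]
    change c * Ts l = (κ l + (1 - κ l) * (αs l / α) ^ 2) / 4 at h1
    linarith
  have hnT : 0 < (finrank ℝ (Q.orthogonal 𝔨.toSubmodule) : ℝ) * Ta := mul_pos (by exact_mod_cast hn) hTa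
  rcases Nat.eq_zero_or_pos r with h0 | h0
  · subst h0
    -- The empty supremum is `0`; the right-hand side is positive because `𝔞 ≠ 0`.
    simp only [Real.iSup_of_isEmpty, mul_zero, Finset.univ_eq_empty, Finset.sum_empty, zero_add]
    positivity
  · have : Nonempty (Fin r) := ⟨⟨0, h0⟩⟩
    obtain ⟨i, hi⟩ := exists_eq_ciSup_of_finite (f := fun i ↦ κ i / Ts i)
    rw [← hi]
    have := mul_lt_mul_of_pos_left (hlt i) hnT
    rw [hnsum] at hle
    linarith

end Inequality

/-! ### The constants `κ_i` and the conclusion. -/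

section Final

variable {E : Type u} [NormedAddCommGroup E] [NormedSpace ℝ E] [FiniteDimensional ℝ E]
  [CompleteSpace E] {H : Type v} [TopologicalSpace H] {I : ModelWithCorners ℝ E H}
  {G : Type w} [TopologicalSpace G] [ChartedSpace H G] [Group G] [LieGroup I ∞ G]

instance instFiniteDimensionalGroupLieAlgebra : FiniteDimensional ℝ (GroupLieAlgebra I G) :=
  inferInstanceAs (FiniteDimensional ℝ E)

/-- The choice in `kappa` is meaningful because invariant symmetric forms on a simple Lie algebra
are proportional to an invariant inner product. -/
lemma killingForm_eq_neg_kappa_mul (hQ : IsInnerProduct (Q I G)) {K : Subgroup G}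
    (J : SimpleIdeal I K) (x y : J.1) :
    killingForm ℝ J.1 x y = -kappa J * Q I G (idealMap J.1 x) (idealMap J.1 y) := by
  refine Classical.epsilon_spec (p := fun κ : ℝ ↦ ∀ x y : J.1,
    killingForm ℝ J.1 x y = -κ * Q I G (idealMap J.1 x) (idealMap J.1 y)) ?_ x y
  obtain ⟨c, hc⟩ := (hQ.restrict (idealMap J.1) (idealMap_injective _)).exists_eq_mul_of_isSimple
    (fun a b c ↦ neg_killingForm_lie _ _ _) J.2 (B := killingForm ℝ J.1)
    (fun a b ↦ LieModule.traceForm_comm ℝ _ _ a b)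
    (fun a b c ↦ LieModule.traceForm_apply_lie_apply ℝ _ _ a b c)
  exact ⟨-c, fun x y ↦ by rw [hc, neg_neg]; rfl⟩

end Final

end PrescribedRicci

end

theorem theorem3p4 {E : Type*} [NormedAddCommGroup E] [NormedSpace ℝ E]
    [FiniteDimensional ℝ E] [CompleteSpace E]
    {H : Type*} [TopologicalSpace H] (I : ModelWithCorners ℝ E H) [I.Boundaryless]
    {G : Type*} [TopologicalSpace G] [ChartedSpace H G] [Group G] [LieGroup I ∞ G]
    [T2Space G] [CompactSpace G]
    (hG : LieAlgebra.IsSimple ℝ (GroupLieAlgebra I G))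
    (K : Subgroup G) (hK : IsClosed (K : Set G))
    (hirr : PrescribedRicci.AdIrreducible I K)
    {r : ℕ} (k : Fin r ≃ PrescribedRicci.SimpleIdeal I K)
    (T : LinearMap.BilinForm ℝ (GroupLieAlgebra I G)) (Ta : ℝ)
    (w : LinearMap.BilinForm ℝ (LieAlgebra.center ℝ (PrescribedRicci.lieAlgebraOf I K)))
    (Ts : Fin r → ℝ) (hT : PrescribedRicci.IsMetricOfForm k T Ta w Ts)
    (hg : ∃ (g : LinearMap.BilinForm ℝ (GroupLieAlgebra I G)) (α : ℝ)
      (h : LinearMap.BilinForm ℝ (LieAlgebra.center ℝ (PrescribedRicci.lieAlgebraOf I K)))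
      (αs : Fin r → ℝ), PrescribedRicci.IsMetricOfForm k g α h αs ∧
        ∃ c : ℝ, 0 < c ∧ PrescribedRicci.HasRicci I (PrescribedRicci.leftInvariant I g)
          (c • PrescribedRicci.leftInvariant I T)) :
    (Module.finrank ℝ (PrescribedRicci.compl I K) : ℝ) * Ta *
        (⨆ i, PrescribedRicci.kappa (k i) / Ts i) <
      2 * ∑ j, (Module.finrank ℝ (k j).1 : ℝ) * (1 - PrescribedRicci.kappa (k j))
        + 2 * (Module.finrank ℝ (LieAlgebra.center ℝ (PrescribedRicci.lieAlgebraOf I K)) : ℝ)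
        + (Module.finrank ℝ (PrescribedRicci.compl I K) : ℝ) := by
  obtain ⟨β, hβ, hinv⟩ := PrescribedRicci.exists_lieInvariant_innerProduct (I := I) (G := G)
  have hQ : PrescribedRicci.IsInnerProduct (PrescribedRicci.Q I G) :=
    PrescribedRicci.isInnerProduct_neg_killingForm hβ hinv
      (PrescribedRicci.IsSimple.eq_zero_of_central hG)
  obtain ⟨g, α, h, αs, hgm, c, -, hRic⟩ := hg
  obtain ⟨Γ, hskew, htor, hΓ⟩ := hRic.exists_connection hgm.isInnerProduct
  exact PrescribedRicci.finrank_mul_iSup_lt hG (fun x ↦ rfl) hQ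
    PrescribedRicci.neg_killingForm_lie hirr.1 (fun i ↦ (k i).2)
    (fun i j hij ↦ k.injective (Subtype.ext hij))
    (fun J hJ ↦ ⟨k.symm ⟨J, hJ⟩, by simp⟩)
    (fun i ↦ PrescribedRicci.killingForm_eq_neg_kappa_mul hQ (k i))
    hT.form hT.pos hT.pos_ideal hgm.form hgm.isInnerProduct hgm.pos hgm.isInnerProduct_center
    hgm.pos_ideal hskew htor hΓ
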